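/- **Theorem 1 (Bounds on the second joint moment of shot noise functions).** Let $\Phi$ be a Poisson point process on $\mathbb R^2$ whose intensity measure has a measurable, non-negative, locally integrable density with respect to area, written $\lambda(r,\theta)$ in polar coordinates. Enumerate the points of $\Phi$ as $x_i$ (with measurable $x_i$; the index set may be random), put $r_i=\|x_i\|$, and let each point carry two real random marks $p_{i,1},p_{i,2}$, all defined on the same probability space. No independence is assumed: the marks may depend on each other and on the points. Let $f_1,f_2:(0,\infty)\to[0,\infty)$ and $q_0,q_1,q_2:(0,\infty)\to\mathbb R$ be continuous, and let $$I_k=\sum_i f_k(r_i)\,p_{i,k},\qquad k=1,2 .$$ Assume that the second joint moment is meaningful: either all marks are almost surely non-negative, or $$E\Big[\Big(\sum_i f_1(r_i)|p_{i,1}|\Big)\Big(\sum_i f_2(r_i)|p_{i,2}|\Big)\Big]<\infty .$$ Put $\bar\lambda(r)=\frac1{2\pi}\int_0^{2\pi}\lambda(r,\theta)\,d\theta$ and assume that the three integrals over $r$ below exist in $[-\infty,\infty]$ (that is, none of them has the form $\infty-\infty$). (a) If for all indices $i,j$, almost surely on the event that the points with indices $i$ and $j$ are present, $$E\big[p_{i,1}p_{j,2}\,\big|\,r_i,r_j\big]\le\begin{cases}q_1(r_i)\,q_2(r_j),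 & i\ne j,\\ q_0(r_i), & i=j,\end{cases}$$ then $$E[I_1I_2]\le\prod_{k=1}^2\Big(2\pi\int_0^\infty f_k(r)q_k(r)\bar\lambda(r)\,r\,dr\Big)+2\pi\int_0^\infty f_1(r)f_2(r)q_0(r)\bar\lambda(r)\,r\,dr .$$ (b) If the inequality $\ge$ holds in the hypothesis of (a) instead of $\le$, then $\ge$ holds in its conclusion. Expectations and integrals take values in $[-\infty,\infty]$, with the conventions $0\cdot(\pm\infty)=0$ and $\infty-\infty=-\infty$, and conditional expectations are means of regular conditional distributions. -/

import Mathlib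

open MeasureTheory ProbabilityTheory

noncomputable section

/-- The plane `ℝ²` with its Euclidean norm. -/
abbrev Plane : Type := EuclideanSpace ℝ (Fin 2)

/-- The integral of an extended real valued function as an extended real number: the integral of
the positive part minus the integral of the negative part. -/
def extIntegral {α : Type*} [MeasurableSpace α] (μ : Measure α) (g : α → EReal) : EReal :=
  ((∫⁻ a, (g a).toENNReal ∂μ : ENNReal) : EReal) - ((∫⁻ a, (-g a).toENNReal ∂μ : ENNReal) : EReal)

/-- The integral of `g` exists as an extended real number, i.e. is not of the form `∞ - ∞`. -/
def ExtIntegralExists {α : Type*} [MeasurableSpace α] (μ : Measure α) (g : α → EReal) : Prop :=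
  ∫⁻ a, (g a).toENNReal ∂μ ≠ ⊤ ∨ ∫⁻ a, (-g a).toENNReal ∂μ ≠ ⊤

/-- Number (possibly infinite) of points in `B`, for the random collection of those points `x i`
whose index `i` is present; `alive i` is the event that the point with index `i` is present. -/
def pointCount {Ω : Type*} (alive : ℕ → Set Ω) (x : ℕ → Ω → Plane) (B : Set Plane) (ω : Ω) : ℕ∞ :=
  Set.encard {i : ℕ | ω ∈ alive i ∧ x i ω ∈ B}

/-- The (enumerated) random points `x i`, `i` present, form a Poisson point process on the plane
with intensity measure `Λ`. -/
structure IsPoissonPointProcess {Ω : Type*} [MeasurableSpace Ω] (P : Measure Ω)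
    (alive : ℕ → Set Ω) (x : ℕ → Ω → Plane) (Λ : Measure Plane) : Prop where
  measurableSet_alive : ∀ i, MeasurableSet (alive i)
  measurable_point : ∀ i, Measurable (x i)
  /-- The number of points in a set of finite intensity has a Poisson law. -/
  poisson_law : ∀ B : Set Plane, MeasurableSet B → Λ B ≠ ⊤ →
    P.map (pointCount alive x B) =
      (poissonMeasure (Λ B).toNNReal).map (fun n : ℕ => (n : ℕ∞))
  /-- The numbers of points in pairwise disjoint sets are independent. -/
  indep : ∀ (n : ℕ) (B : Fin n → Set Plane), (∀ k, MeasurableSet (B k)) →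
    Pairwise (fun k l => Disjoint (B k) (B l)) →
    iIndepFun (fun k => pointCount alive x (B k)) P

/-- The measure on the plane with density `dens` with respect to area. -/
def intensityMeasure (dens : Plane → ℝ) : Measure Plane :=
  volume.withDensity (fun z => ENNReal.ofReal (dens z))

/-- A function on the plane written in polar coordinates: `lam (r, θ)`. -/
def inPolar (dens : Plane → ℝ) (r θ : ℝ) : ℝ :=
  dens !₂[r * Real.cos θ, r * Real.sin θ]

/-- The angular average `(1 / 2π) ∫₀^{2π} lam (r, θ) dθ` of the density. -/
def angularAverage (dens : Plane → ℝ) (r : ℝ) : ℝ :=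
  1 / (2 * Real.pi) * ∫ θ in (0 : ℝ)..(2 * Real.pi), inPolar dens r θ

/-- The contribution `f (r i) * p i` of the point with index `i` to the shot noise, where
`r i = ‖x i‖`; it is zero if there is no point with this index. -/
def shotTerm {Ω : Type*} (alive : ℕ → Set Ω) (x : ℕ → Ω → Plane) (f : ℝ → ℝ) (p : ℕ → Ω → ℝ)
    (i : ℕ) (ω : Ω) : ℝ :=
  (alive i).indicator (fun ω' => f ‖x i ω'‖ * p i ω') ω

/-- The shot noise `∑ i, f (r i) * p i` as an extended real number: the sum of the positive terms
minus the sum of the absolute values of the negative ones. -/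
def shotNoise {Ω : Type*} (alive : ℕ → Set Ω) (x : ℕ → Ω → Plane) (f : ℝ → ℝ) (p : ℕ → Ω → ℝ)
    (ω : Ω) : EReal :=
  ((∑' i, ENNReal.ofReal (shotTerm alive x f p i ω) : ENNReal) : EReal) -
    ((∑' i, ENNReal.ofReal (-shotTerm alive x f p i ω) : ENNReal) : EReal)

/-- The conditional expectation `E[Y | R = b]` on the event `A`, as the mean of a regular
conditional distribution of `Y` given `R`, under `P` restricted to `A`. -/
def condMeanOn {Ω β : Type*} [MeasurableSpace Ω] [MeasurableSpace β] (P : Measure Ω)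
    [IsFiniteMeasure P] (A : Set Ω) (Y : Ω → ℝ) (R : Ω → β) (b : β) : EReal :=
  extIntegral (condDistrib Y R (P.restrict A) b) (fun y : ℝ => (y : EReal))

/-- `E[p_{i,1} p_{j,2} | r_i, r_j]`, given that the points with indices `i` and `j` are present,
at the outcome `ω`. -/
def crossMoment {Ω : Type*} [MeasurableSpace Ω] (P : Measure Ω) [IsFiniteMeasure P]
    (alive : ℕ → Set Ω) (x : ℕ → Ω → Plane) (p₁ p₂ : ℕ → Ω → ℝ) (i j : ℕ) (ω : Ω) : EReal :=
  condMeanOn P (alive i ∩ alive j) (fun ω' => p₁ i ω' * p₂ j ω')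
    (fun ω' => (‖x i ω'‖, ‖x j ω'‖)) (‖x i ω‖, ‖x j ω‖)

/-- The bounding function: `q₁ r * q₂ s` for `i ≠ j`, and `q₀ r` for `i = j`. -/
def crossBound (q₀ q₁ q₂ : ℝ → ℝ) (i j : ℕ) (r s : ℝ) : ℝ :=
  if i = j then q₀ r else q₁ r * q₂ s

/-- The integrand `g r * lamBar r * r` of a radial integral. -/
def radialIntegrand (dens : Plane → ℝ) (g : ℝ → ℝ) (r : ℝ) : EReal :=
  ((g r * angularAverage dens r * r : ℝ) : EReal)

/-- The radial integral `2π ∫₀^∞ g r * lamBar r * r dr`. -/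
def radialIntegral (dens : Plane → ℝ) (g : ℝ → ℝ) : EReal :=
  ((2 * Real.pi : ℝ) : EReal) *
    extIntegral (volume.restrict (Set.Ioi (0 : ℝ))) (radialIntegrand dens g)

end

open scoped ENNReal NNReal

namespace ShotNoise

/-! Expanding the product of the two sums turns E[I₁I₂] into the sum over all index pairs (i, j) of
the mean of f₁(r_i) f₂(r_j) p_{i,1} p_{j,2} on the event that both points are present. The weight
f₁(r_i) f₂(r_j) is a nonnegative function of the radii, so conditioning on (r_i, r_j) lets the
product of the marks be compared with its bound, term by term (`lintegral_le_of_condMean_le`,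
`le_lintegral_of_le_condMean`). What remains is a sum of deterministic functions of one or two
points, which Campbell's formulas evaluate: pairs of distinct points have intensity Λ ⊗ Λ
(`sum_map_pair`), single points have intensity Λ (`sum_map_point`). The off-diagonal bound q₁(r_i)
q₂(r_j) therefore gives a product of two integrals, the diagonal bound q₀ a single one, and polar
coordinates make them radial (`radialIntegral_eq`).

Campbell's formulas are derived from counts: Poisson moments and independence over disjoint sets
give E[N(B)N(C)] = Λ(B)Λ(C) + Λ(B ∩ C), and a π-system argument passes from rectangles to measures.

The remaining care concerns infinite values. Positive and negative parts are kept apart in [0, ∞],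
where sums and integrals may be exchanged freely, and are subtracted only at the end. The assumption
on the joint moment makes its total negative part finite (`extIntegral_shotNoise_mul`). For the
upper bound this dominates the negative part of the bound. For the lower bound the positive part of
the bound is dominated by that of the moment; if the latter is infinite, the moment is ∞ and there
is nothing to prove. -/

/-! ### Arithmetic of differences of extended nonnegative numbers -/

theorem top_sub_mul_sub {a' b b' : ℝ≥0∞} (ha : a' ≠ ⊤) (hb : b ≠ ⊤ ∨ b' ≠ ⊤)
    (h : ⊤ * b + a' * b' ≠ ⊤ ∨ ⊤ * b' + a' * b ≠ ⊤) :
    (((⊤ : ℝ≥0∞) : EReal) - a') * ((b : EReal) - b') =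
      ((⊤ * b + a' * b' : ℝ≥0∞) : EReal) - ((⊤ * b' + a' * b : ℝ≥0∞) : EReal) := by
  lift a' to ℝ≥0 using ha
  have e1 : ((⊤ : ℝ≥0∞) : EReal) - ((a' : ℝ≥0∞) : EReal) = ⊤ := by
    rw [EReal.coe_ennreal_top]; exact EReal.top_sub_coe (a' : ℝ)
  rw [e1]
  rcases eq_or_ne b 0 with rfl | hb0
  · rcases eq_or_ne b' 0 with rfl | hb0'
    · simp
    · have h1 : (a' : ℝ≥0∞) * b' ≠ ⊤ := by simpa [ENNReal.top_mul hb0'] using h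
      have h2 : ((0 : ℝ≥0∞) : EReal) - (b' : EReal) < 0 := by
        rw [EReal.coe_ennreal_zero, zero_sub, EReal.neg_lt_comm, neg_zero]
        exact_mod_cast pos_iff_ne_zero.2 hb0'
      rw [EReal.top_mul_of_neg h2]
      lift (a' : ℝ≥0∞) * b' to ℝ≥0 using h1 with y
      simp only [mul_zero, zero_add, add_zero, ENNReal.top_mul hb0', EReal.coe_ennreal_top]
      rfl
  · rcases eq_or_ne b' 0 with rfl | hb0'
    · have h1 : (a' : ℝ≥0∞) * b ≠ ⊤ := by simpa [ENNReal.top_mul hb0] using h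
      have h2 : 0 < (b : EReal) - ((0 : ℝ≥0∞) : EReal) := by
        simpa [pos_iff_ne_zero] using hb0
      rw [EReal.top_mul_of_pos h2]
      lift (a' : ℝ≥0∞) * b to ℝ≥0 using h1 with y
      simp only [mul_zero, zero_add, add_zero, ENNReal.top_mul hb0, EReal.coe_ennreal_top]
      exact (EReal.top_sub_coe (y : ℝ)).symm
    -- With `b` and `b'` both nonzero, both parts of the expanded product would be infinite, which
    -- `h` excludes.
    · simp [ENNReal.top_mul hb0, ENNReal.top_mul hb0'] at h

theorem neg_coe_sub {a a' : ℝ≥0∞} (ha : a ≠ ⊤ ∨ a' ≠ ⊤) :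
    -((a : EReal) - a') = (a' : EReal) - a := by
  rw [EReal.neg_sub (by simp) (by simpa using ha), add_comm, sub_eq_add_neg]

/-- The distributive law can fail in `EReal`; it holds once neither factor nor the expanded
difference has the form ∞ - ∞. Infinite factors must be allowed because the radial integrals may
diverge. -/
theorem coe_sub_mul_coe_sub {a a' b b' : ℝ≥0∞} (ha : a ≠ ⊤ ∨ a' ≠ ⊤) (hb : b ≠ ⊤ ∨ b' ≠ ⊤)
    (h : a * b + a' * b' ≠ ⊤ ∨ a * b' + a' * b ≠ ⊤) :
    ((a : EReal) - a') * ((b : EReal) - b') =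
      ((a * b + a' * b' : ℝ≥0∞) : EReal) - ((a * b' + a' * b : ℝ≥0∞) : EReal) := by
  have key : ∀ {a a' b b' : ℝ≥0∞}, (a ≠ ⊤ ∨ a' ≠ ⊤) → (b ≠ ⊤ ∨ b' ≠ ⊤) →
      (a * b + a' * b' ≠ ⊤ ∨ a * b' + a' * b ≠ ⊤) → (a = ⊤ ∨ a' = ⊤) →
      ((a : EReal) - a') * ((b : EReal) - b') =
      ((a * b + a' * b' : ℝ≥0∞) : EReal) - ((a * b' + a' * b : ℝ≥0∞) : EReal) := by
    intro a a' b b' ha hb h ht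
    rcases ht with rfl | rfl
    · exact top_sub_mul_sub (by simpa using ha) hb h
    · have h' : ⊤ * b + a * b' ≠ ⊤ ∨ ⊤ * b' + a * b ≠ ⊤ := by
        rwa [or_comm, add_comm (a * b'), add_comm (a * b)] at h
      rw [← neg_coe_sub ha.symm, neg_mul, top_sub_mul_sub (by simpa using ha) hb h',
        neg_coe_sub h', add_comm (a * b), add_comm (a * b')]
  by_cases hA : a = ⊤ ∨ a' = ⊤
  · exact key ha hb h hA
  by_cases hB : b = ⊤ ∨ b' = ⊤
  · rw [mul_comm, key hb ha _ hB]
    · simp only [mul_comm, add_comm]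
    · rw [mul_comm b a, mul_comm b' a', mul_comm b a', mul_comm b' a, add_comm (a' * b)]
      exact h
  push Not at hA hB
  obtain ⟨h1, h2⟩ := hA
  obtain ⟨h3, h4⟩ := hB
  lift a to ℝ≥0 using h1
  lift a' to ℝ≥0 using h2
  lift b to ℝ≥0 using h3
  lift b' to ℝ≥0 using h4
  have e : ∀ y z : ℝ≥0, ((y : ℝ≥0∞) : EReal) - ((z : ℝ≥0∞) : EReal) = ((y - z : ℝ) : EReal) :=
    fun y z => rfl
  rw [e, e, ← EReal.coe_mul]
  norm_cast
  rw [e]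
  congr 1
  push_cast
  ring

theorem coe_sub_eq_coe_sub {a b u v : ℝ≥0∞} (h : a + v = u + b) (hb : b ≠ ⊤) (hv : v ≠ ⊤) :
    (a : EReal) - b = (u : EReal) - v := by
  lift b to ℝ≥0 using hb
  lift v to ℝ≥0 using hv
  rcases eq_or_ne a ⊤ with rfl | ha
  · have : u = ⊤ := by simpa using h.symm
    subst this
    exact (EReal.top_sub_coe (b : ℝ)).trans (EReal.top_sub_coe (v : ℝ)).symm
  · have hu : u ≠ ⊤ := by
      rintro rfl
      simp [ha] at h
    lift a to ℝ≥0 using ha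
    lift u to ℝ≥0 using hu
    norm_cast at h
    have h' : (a : ℝ) + v = u + b := by exact_mod_cast h
    change ((a - b : ℝ) : EReal) = ((u - v : ℝ) : EReal)
    congr 1
    linarith

theorem coe_sub_le_coe_sub {a b u v : ℝ≥0∞} (h : a + v ≤ u + b) (hb : b ≠ ⊤) (hv : v ≠ ⊤) :
    (a : EReal) - b ≤ (u : EReal) - v := by
  lift b to ℝ≥0 using hb
  lift v to ℝ≥0 using hv
  rcases eq_or_ne u ⊤ with rfl | hu
  · exact le_top.trans_eq (EReal.top_sub_coe (v : ℝ)).symm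
  · have ha : a ≠ ⊤ := by
      rintro rfl
      simp [hu] at h
    lift a to ℝ≥0 using ha
    lift u to ℝ≥0 using hu
    norm_cast at h
    have h' : (a : ℝ) + v ≤ u + b := by exact_mod_cast h
    change ((a - b : ℝ) : EReal) ≤ ((u - v : ℝ) : EReal)
    rw [EReal.coe_le_coe_iff]
    linarith

theorem coe_sub_add_coe_sub {a b u v : ℝ≥0∞} (hb : b ≠ ⊤) (hv : v ≠ ⊤) :
    ((a : EReal) - b) + ((u : EReal) - v) = ((a + u : ℝ≥0∞) : EReal) - ((b + v : ℝ≥0∞) : EReal) := by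
  lift b to ℝ≥0 using hb
  lift v to ℝ≥0 using hv
  rw [EReal.coe_ennreal_add, EReal.coe_ennreal_add]
  have e : ∀ (z : EReal) (y : ℝ≥0), z - ((y : ℝ≥0∞) : EReal) = z + ((-y : ℝ) : EReal) :=
    fun z y => rfl
  have e2 : (((b : ℝ≥0∞) : EReal) + ((v : ℝ≥0∞) : EReal)) = (((b + v : ℝ≥0) : ℝ≥0∞) : EReal) := by
    push_cast; rfl
  rw [e2, e, e, e, add_add_add_comm, ← EReal.coe_add]
  congr 2
  push_cast
  ring

theorem coe_sub_ne_bot {a b : ℝ≥0∞} (ha : a ≠ ⊤) : (b : EReal) - a ≠ ⊥ := by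
  rw [sub_eq_add_neg, Ne, EReal.add_eq_bot_iff]
  simp [ha]

/-- The mirror image of `coe_sub_add_coe_sub`, obtained by negating everything; it serves when the
positive parts are the finite ones. -/
theorem coe_sub_add_coe_sub' {a b u v : ℝ≥0∞} (ha : a ≠ ⊤) (hu : u ≠ ⊤) :
    ((a : EReal) - b) + ((u : EReal) - v) = ((a + u : ℝ≥0∞) : EReal) - ((b + v : ℝ≥0∞) : EReal) := by
  rw [← neg_coe_sub (Or.inr ha), ← neg_coe_sub (Or.inr hu),
    ← neg_coe_sub (a := b + v) (Or.inr (ENNReal.add_ne_top.2 ⟨ha, hu⟩)),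
    ← coe_sub_add_coe_sub ha hu, EReal.neg_add (Or.inl (coe_sub_ne_bot ha))
      (Or.inr (coe_sub_ne_bot hu))]
  rfl

theorem real_mul_coe_sub {c : ℝ} (hc : 0 < c) {a b : ℝ≥0∞} (h : a ≠ ⊤ ∨ b ≠ ⊤) :
    (c : EReal) * ((a : EReal) - b) =
      ((ENNReal.ofReal c * a : ℝ≥0∞) : EReal) - ((ENNReal.ofReal c * b : ℝ≥0∞) : EReal) := by
  have := coe_sub_mul_coe_sub (a := ENNReal.ofReal c) (a' := 0) (b := a) (b' := b) (by simp) h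
    (by rcases h with h | h
        · left; simpa using ENNReal.mul_ne_top ENNReal.ofReal_ne_top h
        · right; simpa using ENNReal.mul_ne_top ENNReal.ofReal_ne_top h)
  simpa [EReal.coe_ennreal_ofReal, max_eq_left hc.le] using this

theorem extIntegral_congr {α : Type*} [MeasurableSpace α] {μ : Measure α} {g g' : α → EReal}
    (h : g =ᵐ[μ] g') : extIntegral μ g = extIntegral μ g' := by
  unfold extIntegral
  rw [lintegral_congr_ae (h.mono fun a (ha : g a = g' a) => by rw [ha]),
    lintegral_congr_ae (h.mono fun a (ha : g a = g' a) =>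
      show (-g a).toENNReal = (-g' a).toENNReal by rw [ha])]

/-- Here `u` and `v` may overlap, so they need not be the positive and negative parts of the
integrand; cancelling the common part is legitimate because `v` has finite integral. -/
theorem extIntegral_coe_sub {α : Type*} [MeasurableSpace α] {μ : Measure α} {u v : α → ℝ≥0∞}
    (hu : AEMeasurable u μ) (hv : AEMeasurable v μ) (hfin : ∫⁻ a, v a ∂μ ≠ ⊤) :
    extIntegral μ (fun a => (u a : EReal) - v a) =
      ((∫⁻ a, u a ∂μ : ℝ≥0∞) : EReal) - ((∫⁻ a, v a ∂μ : ℝ≥0∞) : EReal) := by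
  have hvt : ∀ᵐ a ∂μ, v a ≠ ⊤ := (ae_lt_top' hv hfin).mono fun a ha => ha.ne
  have h1 : ∫⁻ a, ((u a : EReal) - v a).toENNReal ∂μ = ∫⁻ a, u a - v a ∂μ := by
    refine lintegral_congr fun a => ?_
    rw [EReal.toENNReal_sub (EReal.coe_ennreal_nonneg _)]; simp
  have h2 : ∫⁻ a, (-((u a : EReal) - v a)).toENNReal ∂μ = ∫⁻ a, v a - u a ∂μ := by
    refine lintegral_congr_ae (hvt.mono fun a ha => ?_)
    dsimp only
    rw [neg_coe_sub (Or.inr ha), EReal.toENNReal_sub (EReal.coe_ennreal_nonneg _)]; simp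
  unfold extIntegral
  rw [h1, h2]
  refine coe_sub_eq_coe_sub ?_ (ne_top_of_le_ne_top hfin (lintegral_mono fun a => tsub_le_self)) hfin
  rw [← lintegral_add_right' _ hv, ← lintegral_add_left' hu]
  refine lintegral_congr fun a => ?_
  -- Both sides are the maximum of `u a` and `v a`.
  rcases le_total (u a) (v a) with h | h
  · rw [tsub_eq_zero_of_le h, zero_add, add_tsub_cancel_of_le h]
  · rw [tsub_eq_zero_of_le h, add_zero, tsub_add_cancel_of_le h]

/-! ### Moments of the Poisson law -/

theorem lintegral_poissonMeasure (r : ℝ≥0) (f : ℕ → ℝ≥0∞) :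
    ∫⁻ n, f n ∂(poissonMeasure r) =
      ∑' n : ℕ, ENNReal.ofReal (Real.exp (-r) * r ^ n / (n.factorial : ℝ)) * f n := by
  simp [poissonMeasure, lintegral_sum_measure, lintegral_smul_measure]

theorem lintegral_natCast_poissonMeasure (r : ℝ≥0) :
    ∫⁻ n : ℕ, (n : ℝ≥0∞) ∂(poissonMeasure r) = r := by
  rw [lintegral_poissonMeasure, tsum_eq_zero_add' ENNReal.summable]
  have h : ∀ n : ℕ, ENNReal.ofReal (Real.exp (-r) * r ^ (n + 1) / ((n + 1).factorial : ℝ)) *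
      ((n + 1 : ℕ) : ℝ≥0∞) =
      r * (ENNReal.ofReal (Real.exp (-r) * r ^ n / (n.factorial : ℝ)) * 1) := by
    intro n
    rw [← ENNReal.ofReal_natCast, ← ENNReal.ofReal_mul (by positivity), mul_one,
      ← ENNReal.ofReal_coe_nnreal, ← ENNReal.ofReal_mul (by positivity)]
    congr 1
    rw [Nat.factorial_succ]
    push_cast
    field_simp
    ring
  simp_rw [h]
  rw [ENNReal.tsum_mul_left, ← lintegral_poissonMeasure]
  simp

/-- The index shift n · rⁿ/n! = r · rⁿ⁻¹/(n-1)! gives E[N · N] = r E[N + 1]; the same shift computes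
the mean. -/
theorem lintegral_natCast_mul_self_poissonMeasure (r : ℝ≥0) :
    ∫⁻ n : ℕ, (n : ℝ≥0∞) * n ∂(poissonMeasure r) = r * r + r := by
  rw [lintegral_poissonMeasure, tsum_eq_zero_add' ENNReal.summable]
  have h : ∀ n : ℕ, ENNReal.ofReal (Real.exp (-r) * r ^ (n + 1) / ((n + 1).factorial : ℝ)) *
      (((n + 1 : ℕ) : ℝ≥0∞) * ((n + 1 : ℕ) : ℝ≥0∞)) =
      r * (ENNReal.ofReal (Real.exp (-r) * r ^ n / (n.factorial : ℝ)) * ((n : ℝ≥0∞) + 1)) := by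
    intro n
    rw [show (n : ℝ≥0∞) + 1 = ((n + 1 : ℕ) : ℝ≥0∞) by push_cast; rfl,
      ← ENNReal.ofReal_natCast, ← ENNReal.ofReal_mul (by positivity),
      ← ENNReal.ofReal_mul (by positivity), ← ENNReal.ofReal_mul (by positivity),
      ← ENNReal.ofReal_coe_nnreal, ← ENNReal.ofReal_mul (by positivity)]
    congr 1
    rw [Nat.factorial_succ]
    push_cast
    field_simp
    ring
  simp_rw [h]
  rw [ENNReal.tsum_mul_left, ← lintegral_poissonMeasure, lintegral_add_right _ measurable_const,
    lintegral_natCast_poissonMeasure]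
  simp [mul_add]

/-! ### Point counts and Campbell's formulas -/

theorem coe_pointCount {Ω : Type*} (alive : ℕ → Set Ω) (x : ℕ → Ω → Plane) (B : Set Plane) (ω : Ω) :
    (pointCount alive x B ω : ℝ≥0∞) = ∑' i, (alive i ∩ x i ⁻¹' B).indicator 1 ω := by
  rw [pointCount, ← ENNReal.tsum_set_one, tsum_subtype _ fun _ => (1 : ℝ≥0∞)]
  rfl

theorem pointCount_union {Ω : Type*} (alive : ℕ → Set Ω) (x : ℕ → Ω → Plane) {B C : Set Plane}
    (h : Disjoint B C) (ω : Ω) :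
    pointCount alive x (B ∪ C) ω = pointCount alive x B ω + pointCount alive x C ω := by
  unfold pointCount
  rw [← Set.encard_union_eq]
  · congr 1
    ext i
    simp [and_or_left]
  · rw [Set.disjoint_left]
    rintro i ⟨-, h1⟩ ⟨-, h2⟩
    exact Set.disjoint_left.1 h h1 h2

section Campbell

variable {Ω : Type*} [MeasurableSpace Ω] {P : Measure Ω} {alive : ℕ → Set Ω} {x : ℕ → Ω → Plane}
  {Λ : Measure Plane}

theorem measurableSet_alive_inter (h : IsPoissonPointProcess P alive x Λ) {B : Set Plane}
    (hB : MeasurableSet B) (i : ℕ) : MeasurableSet (alive i ∩ x i ⁻¹' B) :=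
  (h.measurableSet_alive i).inter (h.measurable_point i hB)

theorem measurable_pointCount (h : IsPoissonPointProcess P alive x Λ) {B : Set Plane}
    (hB : MeasurableSet B) : Measurable (pointCount alive x B) := by
  have h1 : Measurable fun ω => (pointCount alive x B ω : ℝ≥0∞) := by
    simp_rw [coe_pointCount]
    exact Measurable.tsum fun i =>
      measurable_one.indicator (measurableSet_alive_inter h hB i)
  refine measurable_to_countable' fun n => ?_
  have : pointCount alive x B ⁻¹' {n} =
      (fun ω => (pointCount alive x B ω : ℝ≥0∞)) ⁻¹' {(n : ℝ≥0∞)} := by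
    ext ω; simp
  rw [this]
  exact h1 (measurableSet_singleton _)

theorem lintegral_comp_pointCount (h : IsPoissonPointProcess P alive x Λ) {B : Set Plane}
    (hB : MeasurableSet B) (hfin : Λ B ≠ ⊤) (f : ℕ∞ → ℝ≥0∞) :
    ∫⁻ ω, f (pointCount alive x B ω) ∂P = ∫⁻ n : ℕ, f n ∂(poissonMeasure (Λ B).toNNReal) := by
  rw [← lintegral_map (f := f) (Measurable.of_discrete) (measurable_pointCount h hB),
    h.poisson_law B hB hfin, lintegral_map Measurable.of_discrete Measurable.of_discrete]

theorem lintegral_pointCount (h : IsPoissonPointProcess P alive x Λ) {B : Set Plane}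
    (hB : MeasurableSet B) (hfin : Λ B ≠ ⊤) :
    ∫⁻ ω, (pointCount alive x B ω : ℝ≥0∞) ∂P = Λ B := by
  rw [lintegral_comp_pointCount h hB hfin fun n => (n : ℝ≥0∞)]
  simp [lintegral_natCast_poissonMeasure, hfin]

theorem lintegral_pointCount_mul_self (h : IsPoissonPointProcess P alive x Λ) {B : Set Plane}
    (hB : MeasurableSet B) (hfin : Λ B ≠ ⊤) :
    ∫⁻ ω, (pointCount alive x B ω : ℝ≥0∞) * pointCount alive x B ω ∂P = Λ B * Λ B + Λ B := by
  rw [lintegral_comp_pointCount h hB hfin fun n => (n : ℝ≥0∞) * n]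
  simp [lintegral_natCast_mul_self_poissonMeasure, hfin]

theorem lintegral_pointCount_mul_of_disjoint (h : IsPoissonPointProcess P alive x Λ)
    {B C : Set Plane} (hB : MeasurableSet B) (hC : MeasurableSet C) (hfB : Λ B ≠ ⊤)
    (hfC : Λ C ≠ ⊤) (hd : Disjoint B C) :
    ∫⁻ ω, (pointCount alive x B ω : ℝ≥0∞) * pointCount alive x C ω ∂P = Λ B * Λ C := by
  have hi := h.indep 2 ![B, C] (by intro k; fin_cases k <;> assumption)
    (by
      intro k l hkl
      fin_cases k <;> fin_cases l
      · exact absurd rfl hkl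
      · exact hd
      · exact hd.symm
      · exact absurd rfl hkl)
  have hi' : IndepFun (pointCount alive x B) (pointCount alive x C) P :=
    hi.indepFun (i := 0) (j := 1) (by decide)
  have hc : Measurable fun n : ℕ∞ => (n : ℝ≥0∞) := Measurable.of_discrete
  have := lintegral_mul_eq_lintegral_mul_lintegral_of_indepFun
    (hc.comp (measurable_pointCount h hB)) (hc.comp (measurable_pointCount h hC))
    (hi'.comp hc hc)
  simp only [Pi.mul_apply, Function.comp_apply] at this
  rw [this, lintegral_pointCount h hB hfB, lintegral_pointCount h hC hfC]

/-- Splitting along `B \ C`, `C \ B` and `B ∩ C` leaves products of independent counts, apart from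
the square of the count in `B ∩ C`, whose Poisson second moment supplies the extra term. -/
theorem lintegral_pointCount_mul (h : IsPoissonPointProcess P alive x Λ)
    {B C : Set Plane} (hB : MeasurableSet B) (hC : MeasurableSet C) (hfB : Λ B ≠ ⊤)
    (hfC : Λ C ≠ ⊤) :
    ∫⁻ ω, (pointCount alive x B ω : ℝ≥0∞) * pointCount alive x C ω ∂P =
      Λ B * Λ C + Λ (B ∩ C) := by
  have hc : Measurable fun n : ℕ∞ => (n : ℝ≥0∞) := Measurable.of_discrete
  have hD : MeasurableSet (B ∩ C) := hB.inter hC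
  have hB' : MeasurableSet (B \ C) := hB.diff hC
  have hC' : MeasurableSet (C \ B) := hC.diff hB
  have fD : Λ (B ∩ C) ≠ ⊤ := measure_ne_top_of_subset Set.inter_subset_left hfB
  have fB : Λ (B \ C) ≠ ⊤ := measure_ne_top_of_subset Set.sdiff_subset hfB
  have fC : Λ (C \ B) ≠ ⊤ := measure_ne_top_of_subset Set.sdiff_subset hfC
  have dB : Disjoint (B \ C) (B ∩ C) := Set.disjoint_sdiff_inter
  have dC : Disjoint (C \ B) (B ∩ C) := by rw [Set.inter_comm]; exact Set.disjoint_sdiff_inter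
  have dd : Disjoint (B \ C) (C \ B) := disjoint_sdiff_sdiff
  have eB : B = (B \ C) ∪ (B ∩ C) := (Set.sdiff_union_inter B C).symm
  have eC : C = (C \ B) ∪ (B ∩ C) := by rw [Set.inter_comm]; exact (Set.sdiff_union_inter C B).symm
  have mB := hc.comp (measurable_pointCount h hB')
  have mC := hc.comp (measurable_pointCount h hC')
  have mD := hc.comp (measurable_pointCount h hD)
  simp only [Function.comp_def] at mB mC mD
  have e : ∀ ω, (pointCount alive x B ω : ℝ≥0∞) * pointCount alive x C ω =
      ((pointCount alive x (B \ C) ω : ℝ≥0∞) * pointCount alive x (C \ B) ω +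
      (pointCount alive x (B \ C) ω : ℝ≥0∞) * pointCount alive x (B ∩ C) ω) +
      ((pointCount alive x (C \ B) ω : ℝ≥0∞) * pointCount alive x (B ∩ C) ω +
      (pointCount alive x (B ∩ C) ω : ℝ≥0∞) * pointCount alive x (B ∩ C) ω) := by
    intro ω
    have h1 := pointCount_union alive x dB ω
    have h2 := pointCount_union alive x dC ω
    rw [← eB] at h1
    rw [← eC] at h2
    rw [h1, h2, ENat.toENNReal_add, ENat.toENNReal_add]
    ring
  simp_rw [e]
  rw [lintegral_add_left (by fun_prop), lintegral_add_left (by fun_prop),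
    lintegral_add_left (by fun_prop), lintegral_pointCount_mul_of_disjoint h hB' hC' fB fC dd,
    lintegral_pointCount_mul_of_disjoint h hB' hD fB fD dB,
    lintegral_pointCount_mul_of_disjoint h hC' hD fC fD dC, lintegral_pointCount_mul_self h hD fD]
  have g1 : Λ B = Λ (B \ C) + Λ (B ∩ C) := (measure_sdiff_add_inter B hC).symm
  have g2 : Λ C = Λ (C \ B) + Λ (B ∩ C) := by
    rw [Set.inter_comm]; exact (measure_sdiff_add_inter C hB).symm
  rw [g1, g2]
  ring

/-- The Poisson law is prescribed only on sets of finite intensity, so these must serve as the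
generating π-system. -/
theorem generateFrom_finite_measure (Λ : Measure Plane) [SigmaFinite Λ] :
    MeasurableSpace.generateFrom {s | MeasurableSet s ∧ Λ s ≠ ⊤} =
      (inferInstance : MeasurableSpace Plane) := by
  refine le_antisymm (MeasurableSpace.generateFrom_le fun s hs => hs.1) fun s hs => ?_
  rw [← Set.inter_univ s, ← iUnion_spanningSets Λ, Set.inter_iUnion]
  refine MeasurableSet.iUnion fun n => MeasurableSpace.measurableSet_generateFrom
    ⟨hs.inter (measurableSet_spanningSets Λ n), ?_⟩
  exact measure_ne_top_of_subset Set.inter_subset_right (measure_spanningSets_lt_top Λ n).ne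

theorem isPiSystem_finite_measure (Λ : Measure Plane) :
    IsPiSystem {s | MeasurableSet s ∧ Λ s ≠ ⊤} := fun _ hs _ ht _ =>
  ⟨hs.1.inter ht.1, measure_ne_top_of_subset Set.inter_subset_left hs.2⟩

/-- The spanning sets of a sigma-finite measure, among the sets of finite measure. -/
def finiteSpanningSets (Λ : Measure Plane) [SigmaFinite Λ] :
    Λ.FiniteSpanningSetsIn {s | MeasurableSet s ∧ Λ s ≠ ⊤} where
  set := spanningSets Λ
  set_mem n := ⟨measurableSet_spanningSets Λ n, (measure_spanningSets_lt_top Λ n).ne⟩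
  finite n := measure_spanningSets_lt_top Λ n
  spanning := iUnion_spanningSets Λ

theorem sum_map_point (h : IsPoissonPointProcess P alive x Λ) [SigmaFinite Λ] :
    Measure.sum (fun i => (P.restrict (alive i)).map (x i)) = Λ := by
  refine ((finiteSpanningSets Λ).ext (generateFrom_finite_measure Λ).symm
    (isPiSystem_finite_measure Λ) fun s hs => ?_).symm
  rw [Measure.sum_apply _ hs.1, ← lintegral_pointCount h hs.1 hs.2]
  simp_rw [coe_pointCount]
  rw [lintegral_tsum fun i =>
    (measurable_one.indicator (measurableSet_alive_inter h hs.1 i)).aemeasurable]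
  refine tsum_congr fun i => ?_
  rw [lintegral_indicator_one (measurableSet_alive_inter h hs.1 i),
    Measure.map_apply (h.measurable_point i) hs.1,
    Measure.restrict_apply (h.measurable_point i hs.1), Set.inter_comm]

theorem tsum_prod_eq_offDiag_add_diag (F : ℕ × ℕ → ℝ≥0∞) :
    ∑' ij, F ij = ∑' ij : ℕ × ℕ, (if ij.1 = ij.2 then 0 else F ij) + ∑' i, F (i, i) := by
  have : ∀ ij : ℕ × ℕ, F ij = (if ij.1 = ij.2 then 0 else F ij) +
      (if ij.1 = ij.2 then F ij else 0) := by
    intro ij; split_ifs <;> simp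
  rw [tsum_congr this, ENNReal.tsum_add]
  congr 1
  rw [ENNReal.tsum_prod']
  refine tsum_congr fun i => ?_
  rw [tsum_eq_single i fun j hj => if_neg (Ne.symm hj)]
  simp

/-- The second factorial moment measure of a Poisson process is Λ ⊗ Λ: on a rectangle s × t,
removing the diagonal pairs from E[N(s)N(t)] removes exactly Λ(s ∩ t). -/
theorem sum_map_pair (h : IsPoissonPointProcess P alive x Λ) [SigmaFinite Λ] :
    Measure.sum (fun ij : ℕ × ℕ => if ij.1 = ij.2 then 0 else
      (P.restrict (alive ij.1 ∩ alive ij.2)).map (fun ω => (x ij.1 ω, x ij.2 ω))) = Λ.prod Λ := by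
  refine (Measure.prod_eq_generateFrom (generateFrom_finite_measure Λ)
    (generateFrom_finite_measure Λ) (isPiSystem_finite_measure Λ) (isPiSystem_finite_measure Λ)
    (finiteSpanningSets Λ) (finiteSpanningSets Λ) fun s hs t ht => ?_).symm
  rw [Measure.sum_apply _ (hs.1.prod ht.1)]
  have fD : Λ (s ∩ t) ≠ ⊤ := measure_ne_top_of_subset Set.inter_subset_left hs.2
  -- Subtraction is avoided: the finite diagonal contribution is added to both sides.
  refine (ENNReal.add_left_inj fD).1 ?_
  rw [← lintegral_pointCount_mul h hs.1 ht.1 hs.2 ht.2,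
    ← lintegral_pointCount h (hs.1.inter ht.1) fD]
  have ms : ∀ i, Measurable ((alive i ∩ x i ⁻¹' s).indicator (1 : Ω → ℝ≥0∞)) := fun i =>
    measurable_one.indicator (measurableSet_alive_inter h hs.1 i)
  have mt : ∀ i, Measurable ((alive i ∩ x i ⁻¹' t).indicator (1 : Ω → ℝ≥0∞)) := fun i =>
    measurable_one.indicator (measurableSet_alive_inter h ht.1 i)
  have e1 : ∀ ω, (pointCount alive x s ω : ℝ≥0∞) * pointCount alive x t ω =
      ∑' ij : ℕ × ℕ, (alive ij.1 ∩ x ij.1 ⁻¹' s).indicator (1 : Ω → ℝ≥0∞) ω *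
        (alive ij.2 ∩ x ij.2 ⁻¹' t).indicator (1 : Ω → ℝ≥0∞) ω := by
    intro ω
    rw [coe_pointCount, coe_pointCount, ENNReal.tsum_prod']
    simp_rw [ENNReal.tsum_mul_left, ENNReal.tsum_mul_right]
  simp_rw [e1, coe_pointCount]
  have mst : ∀ ij : ℕ × ℕ, Measurable fun ω => (alive ij.1 ∩ x ij.1 ⁻¹' s).indicator (1 : Ω → ℝ≥0∞) ω *
      (alive ij.2 ∩ x ij.2 ⁻¹' t).indicator (1 : Ω → ℝ≥0∞) ω := fun ij => (ms ij.1).mul (mt ij.2)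
  rw [lintegral_tsum (fun i : ℕ × ℕ => (mst i).aemeasurable),
    tsum_prod_eq_offDiag_add_diag fun ij : ℕ × ℕ =>
      ∫⁻ ω, (alive ij.1 ∩ x ij.1 ⁻¹' s).indicator (1 : Ω → ℝ≥0∞) ω *
        (alive ij.2 ∩ x ij.2 ⁻¹' t).indicator (1 : Ω → ℝ≥0∞) ω ∂P, lintegral_tsum fun i =>
    (measurable_one.indicator (measurableSet_alive_inter h (hs.1.inter ht.1) i)).aemeasurable]
  congr 1
  · refine tsum_congr fun ij => ?_
    split_ifs
    · rfl
    · have mp : Measurable fun ω => (x ij.1 ω, x ij.2 ω) :=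
        (h.measurable_point ij.1).prodMk (h.measurable_point ij.2)
      rw [Measure.map_apply mp (hs.1.prod ht.1), Measure.restrict_apply (mp (hs.1.prod ht.1)),
        ← lintegral_indicator_one ((mp (hs.1.prod ht.1)).inter
          ((h.measurableSet_alive _).inter (h.measurableSet_alive _)))]
      refine lintegral_congr fun ω => ?_
      rw [← Pi.mul_apply, ← Set.inter_indicator_one]
      refine congrFun (congrFun (congrArg _ (Set.ext fun ω => ?_)) _) ω
      simp only [Set.mem_inter_iff, Set.mem_preimage, Set.mem_prod]
      tauto
  · refine tsum_congr fun i => lintegral_congr fun ω => ?_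
    rw [← Pi.mul_apply, ← Set.inter_indicator_one]
    refine congrFun (congrFun (congrArg _ (Set.ext fun ω => ?_)) _) ω
    simp only [Set.mem_inter_iff, Set.mem_preimage]
    tauto

theorem tsum_lintegral_point (h : IsPoissonPointProcess P alive x Λ) [SigmaFinite Λ]
    {g : Plane → ℝ≥0∞} (hg : Measurable g) :
    ∑' i, ∫⁻ ω in alive i, g (x i ω) ∂P = ∫⁻ z, g z ∂Λ := by
  conv_rhs => rw [← sum_map_point h]
  rw [lintegral_sum_measure]
  exact tsum_congr fun i => (lintegral_map hg (h.measurable_point i)).symm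

theorem tsum_lintegral_pair (h : IsPoissonPointProcess P alive x Λ) [SigmaFinite Λ]
    {g : Plane × Plane → ℝ≥0∞} (hg : Measurable g) :
    ∑' ij : ℕ × ℕ, (if ij.1 = ij.2 then 0 else
      ∫⁻ ω in alive ij.1 ∩ alive ij.2, g (x ij.1 ω, x ij.2 ω) ∂P) = ∫⁻ z, g z ∂(Λ.prod Λ) := by
  rw [← sum_map_pair h, lintegral_sum_measure]
  refine tsum_congr fun ij => ?_
  split_ifs
  · simp
  · exact (lintegral_map hg ((h.measurable_point ij.1).prodMk (h.measurable_point ij.2))).symm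

/-- The law of each present point is one of the summands that make up Λ, so it inherits the null
sets of Λ. -/
theorem ae_point_ne (h : IsPoissonPointProcess P alive x Λ) [SigmaFinite Λ] {z : Plane}
    (hz : Λ {z} = 0) : ∀ᵐ ω ∂P, ∀ i, ω ∈ alive i → x i ω ≠ z := by
  rw [ae_all_iff]
  intro i
  rw [← ae_restrict_iff' (h.measurableSet_alive i)]
  have h0 := hz
  rw [← sum_map_point h, Measure.sum_apply _ (measurableSet_singleton z),
    ENNReal.tsum_eq_zero] at h0
  have h1 := h0 i
  rw [Measure.map_apply (h.measurable_point i) (measurableSet_singleton z)] at h1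
  rw [ae_iff]
  convert! h1 using 2
  ext ω
  simp

end Campbell

/-! ### Polar coordinates and radial integrals -/

section Polar

theorem lintegral_plane (G : Plane → ℝ≥0∞) :
    ∫⁻ z, G z = ∫⁻ p : ℝ × ℝ, G !₂[p.1, p.2] := by
  have h1 := (PiLp.volume_preserving_toLp (Fin 2)).lintegral_comp_emb
    (MeasurableEquiv.toLp 2 (Fin 2 → ℝ)).measurableEmbedding G
  have h2 := (volume_preserving_finTwoArrow ℝ).symm.lintegral_comp_emb
    (MeasurableEquiv.finTwoArrow (α := ℝ)).symm.measurableEmbedding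
    (fun v : Fin 2 → ℝ => G (WithLp.toLp 2 v))
  rw [← h1, ← h2]
  rfl

theorem lintegral_polar {G : Plane → ℝ≥0∞} (hG : Measurable G) :
    ∫⁻ z, G z = ∫⁻ r in Set.Ioi (0 : ℝ), ENNReal.ofReal r *
      ∫⁻ θ in Set.Ioc (0 : ℝ) (2 * Real.pi), G !₂[r * Real.cos θ, r * Real.sin θ] := by
  have hm : Measurable fun p : ℝ × ℝ => G !₂[p.1 * Real.cos p.2, p.1 * Real.sin p.2] := by
    refine hG.comp ((WithLp.measurable_toLp 2 _).comp (measurable_pi_iff.2 fun i => ?_))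
    fin_cases i <;> simp <;> fun_prop
  rw [lintegral_plane, ← lintegral_comp_polarCoord_symm]
  simp only [polarCoord_target, polarCoord_symm_apply, smul_eq_mul]
  rw [Measure.volume_eq_prod, ← Measure.prod_restrict, lintegral_prod _ (by fun_prop)]
  refine lintegral_congr fun r => ?_
  have hm' : Measurable fun θ => G !₂[r * Real.cos θ, r * Real.sin θ] :=
    hm.comp measurable_prodMk_left
  dsimp only
  rw [lintegral_const_mul _ hm']
  congr 1
  -- The polar chart has angles in (-π, π); periodicity moves the integral to (0, 2π].
  have hper : Function.Periodic
      (fun θ => G !₂[r * Real.cos θ, r * Real.sin θ]) (2 * Real.pi) := by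
    intro θ; simp
  have h3 := (isAddFundamentalDomain_Ioc Real.two_pi_pos (-Real.pi)).setLIntegral_eq
    (isAddFundamentalDomain_Ioc Real.two_pi_pos 0)
    (fun θ => G !₂[r * Real.cos θ, r * Real.sin θ]) hper.map_vadd_zmultiples
  rw [show -Real.pi + 2 * Real.pi = Real.pi by ring, zero_add] at h3
  rw [← h3]
  exact setLIntegral_congr Ioo_ae_eq_Ioc

theorem norm_polar {r : ℝ} (hr : 0 < r) (θ : ℝ) :
    ‖(!₂[r * Real.cos θ, r * Real.sin θ] : Plane)‖ = r := by
  rw [EuclideanSpace.norm_eq]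
  simp only [Fin.sum_univ_two, Real.norm_eq_abs, sq_abs]
  simp only [Matrix.cons_val_zero, Matrix.cons_val_one]
  rw [show (r * Real.cos θ) ^ 2 + (r * Real.sin θ) ^ 2 = r ^ 2 * (Real.sin θ ^ 2 + Real.cos θ ^ 2) by
    ring, Real.sin_sq_add_cos_sq, mul_one, Real.sqrt_sq hr.le]

variable {dens : Plane → ℝ}

theorem measurable_inPolar (hd : Measurable dens) (r : ℝ) : Measurable (inPolar dens r) := by
  refine hd.comp ((WithLp.measurable_toLp 2 _).comp (measurable_pi_iff.2 fun i => ?_))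
  fin_cases i <;> simp <;> fun_prop

theorem measurable_lintegral_inPolar (hd : Measurable dens) :
    Measurable fun r => ∫⁻ θ in Set.Ioc (0 : ℝ) (2 * Real.pi), ENNReal.ofReal (inPolar dens r θ) := by
  have hm : Measurable fun p : ℝ × ℝ => ENNReal.ofReal (inPolar dens p.1 p.2) := by
    refine ENNReal.measurable_ofReal.comp
      (hd.comp ((WithLp.measurable_toLp 2 _).comp (measurable_pi_iff.2 fun i => ?_)))
    fin_cases i <;> simp <;> fun_prop
  exact hm.lintegral_prod_right'

theorem lintegral_norm_intensityMeasure (hd : Measurable dens) {g : ℝ → ℝ≥0∞} (hg : Measurable g) :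
    ∫⁻ z, g ‖z‖ ∂(intensityMeasure dens) = ∫⁻ r in Set.Ioi (0 : ℝ), g r * (ENNReal.ofReal r *
      ∫⁻ θ in Set.Ioc (0 : ℝ) (2 * Real.pi), ENNReal.ofReal (inPolar dens r θ)) := by
  have hgn : Measurable fun z : Plane => g ‖z‖ := hg.comp measurable_norm
  rw [intensityMeasure, lintegral_withDensity_eq_lintegral_mul _ hd.ennreal_ofReal hgn, lintegral_polar (by fun_prop)]
  refine setLIntegral_congr_fun measurableSet_Ioi fun r hr => ?_
  simp only [Pi.mul_apply, norm_polar hr]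
  change _ * ∫⁻ θ in _, ENNReal.ofReal (inPolar dens r θ) * g r = _
  rw [lintegral_mul_const _ (measurable_inPolar hd r).ennreal_ofReal, ← mul_assoc, mul_comm]

/-- Discs have finite intensity, so almost every circle has finite angular integral. Without this
the Bochner integral in `angularAverage` could take its default value 0 where the true average is
infinite. -/
theorem ae_lintegral_inPolar_ne_top (hd : Measurable dens)
    (hloc : LocallyIntegrable dens volume) :
    ∀ᵐ r ∂(volume.restrict (Set.Ioi (0 : ℝ))),
      ∫⁻ θ in Set.Ioc (0 : ℝ) (2 * Real.pi), ENNReal.ofReal (inPolar dens r θ) ≠ ⊤ := by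
  have hn : ∀ n : ℕ, ∀ᵐ r ∂(volume.restrict (Set.Ioi (0 : ℝ))), r ≤ (n : ℝ) →
      ∫⁻ θ in Set.Ioc (0 : ℝ) (2 * Real.pi), ENNReal.ofReal (inPolar dens r θ) ≠ ⊤ := by
    intro n
    have hgm : Measurable ((Set.Iic (n : ℝ)).indicator (1 : ℝ → ℝ≥0∞)) :=
      measurable_one.indicator measurableSet_Iic
    have h1 := lintegral_norm_intensityMeasure hd hgm
    have h2 : ∫⁻ z, (Set.Iic (n : ℝ)).indicator (1 : ℝ → ℝ≥0∞) ‖z‖ ∂(intensityMeasure dens) ≠ ⊤ := by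
      have e : (fun z : Plane => (Set.Iic (n : ℝ)).indicator (1 : ℝ → ℝ≥0∞) ‖z‖) =
          (Metric.closedBall (0 : Plane) n).indicator 1 := by
        ext z; simp [Set.indicator]
      rw [e, lintegral_indicator_one measurableSet_closedBall, intensityMeasure,
        withDensity_apply _ measurableSet_closedBall]
      have := (hloc.integrableOn_isCompact (isCompact_closedBall (0 : Plane) n)).2
      refine ((lintegral_mono fun z => ?_).trans_lt this).ne
      exact Real.ofReal_le_enorm _
    rw [h1] at h2
    filter_upwards [ae_lt_top (hgm.mul (ENNReal.measurable_ofReal.mul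
      (measurable_lintegral_inPolar hd))) h2, ae_restrict_mem measurableSet_Ioi] with r hr hr0 hrn
    intro htop
    have hr0' : (0 : ℝ) < r := hr0
    simp [htop, hrn, ENNReal.mul_top, hr0'] at hr
  filter_upwards [ae_all_iff.2 hn] with r hr
  obtain ⟨n, hn⟩ := exists_nat_ge r
  exact hr n hn

theorem ofReal_angularAverage (hd : Measurable dens) (hd0 : ∀ z, 0 ≤ dens z) {r : ℝ}
    (hr : ∫⁻ θ in Set.Ioc (0 : ℝ) (2 * Real.pi), ENNReal.ofReal (inPolar dens r θ) ≠ ⊤) :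
    ENNReal.ofReal (2 * Real.pi) * ENNReal.ofReal (angularAverage dens r) =
      ∫⁻ θ in Set.Ioc (0 : ℝ) (2 * Real.pi), ENNReal.ofReal (inPolar dens r θ) := by
  have hint : Integrable (inPolar dens r) (volume.restrict (Set.Ioc (0 : ℝ) (2 * Real.pi))) := by
    refine ⟨(measurable_inPolar hd r).aestronglyMeasurable, ?_⟩
    rw [hasFiniteIntegral_iff_ofReal (f := inPolar dens r)
      (Filter.Eventually.of_forall fun θ => hd0 _)]
    exact hr.lt_top
  rw [← ofReal_integral_eq_lintegral_ofReal hint (Filter.Eventually.of_forall fun θ => hd0 _),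
    ← ENNReal.ofReal_mul Real.two_pi_pos.le, angularAverage,
    intervalIntegral.integral_of_le Real.two_pi_pos.le, ← mul_assoc,
    mul_one_div_cancel Real.two_pi_pos.ne', one_mul]

theorem angularAverage_nonneg (hd0 : ∀ z, 0 ≤ dens z) (r : ℝ) : 0 ≤ angularAverage dens r := by
  rw [angularAverage]
  have := intervalIntegral.integral_nonneg (μ := volume) (f := inPolar dens r) Real.two_pi_pos.le
    fun θ _ => hd0 _
  have := Real.two_pi_pos
  positivity

/-- The angular average and the radius are nonnegative, so taking the positive part affects only
`g`. -/
theorem lintegral_norm_eq_radial (hd : Measurable dens) (hd0 : ∀ z, 0 ≤ dens z)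
    (hloc : LocallyIntegrable dens volume) {g : ℝ → ℝ} (hg : Measurable g) :
    ∫⁻ z, ENNReal.ofReal (g ‖z‖) ∂(intensityMeasure dens) = ENNReal.ofReal (2 * Real.pi) *
      ∫⁻ r in Set.Ioi (0 : ℝ), ENNReal.ofReal (g r * angularAverage dens r * r) := by
  rw [lintegral_norm_intensityMeasure hd hg.ennreal_ofReal,
    ← lintegral_const_mul' _ _ ENNReal.ofReal_ne_top]
  refine lintegral_congr_ae ?_
  filter_upwards [ae_lintegral_inPolar_ne_top hd hloc, ae_restrict_mem measurableSet_Ioi]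
    with r hr hr0
  have hr0' : (0 : ℝ) < r := hr0
  rw [← ofReal_angularAverage hd hd0 hr, ENNReal.ofReal_mul' hr0'.le,
    ENNReal.ofReal_mul' (angularAverage_nonneg hd0 r)]
  ring

theorem toENNReal_neg_radialIntegrand (dens : Plane → ℝ) (g : ℝ → ℝ) (r : ℝ) :
    (-radialIntegrand dens g r).toENNReal =
      ENNReal.ofReal (-g r * angularAverage dens r * r) := by
  rw [radialIntegrand, ← EReal.coe_neg, EReal.real_coe_toENNReal]
  congr 1
  ring

theorem lintegral_norm_ne_top_or (hd : Measurable dens) (hd0 : ∀ z, 0 ≤ dens z)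
    (hloc : LocallyIntegrable dens volume) {g : ℝ → ℝ} (hg : Measurable g)
    (hJ : ExtIntegralExists (volume.restrict (Set.Ioi (0 : ℝ))) (radialIntegrand dens g)) :
    ∫⁻ z, ENNReal.ofReal (g ‖z‖) ∂(intensityMeasure dens) ≠ ⊤ ∨
      ∫⁻ z, ENNReal.ofReal (-g ‖z‖) ∂(intensityMeasure dens) ≠ ⊤ := by
  rw [lintegral_norm_eq_radial hd hd0 hloc hg, lintegral_norm_eq_radial hd hd0 hloc (g := fun r => -g r) hg.neg]
  refine hJ.imp (fun h => ENNReal.mul_ne_top ENNReal.ofReal_ne_top h)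
    fun h => ENNReal.mul_ne_top ENNReal.ofReal_ne_top ?_
  simpa only [toENNReal_neg_radialIntegrand] using h

theorem radialIntegral_eq (hd : Measurable dens) (hd0 : ∀ z, 0 ≤ dens z)
    (hloc : LocallyIntegrable dens volume) {g : ℝ → ℝ} (hg : Measurable g)
    (hJ : ExtIntegralExists (volume.restrict (Set.Ioi (0 : ℝ))) (radialIntegrand dens g)) :
    radialIntegral dens g =
      ((∫⁻ z, ENNReal.ofReal (g ‖z‖) ∂(intensityMeasure dens) : ℝ≥0∞) : EReal) -
      ((∫⁻ z, ENNReal.ofReal (-g ‖z‖) ∂(intensityMeasure dens) : ℝ≥0∞) : EReal) := by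
  rw [lintegral_norm_eq_radial hd hd0 hloc hg, lintegral_norm_eq_radial hd hd0 hloc (g := fun r => -g r) hg.neg,
    radialIntegral, extIntegral, real_mul_coe_sub Real.two_pi_pos hJ]
  simp only [toENNReal_neg_radialIntegrand]
  rfl

end Polar

/-- If the inequality of sums failed, its reverse would give equality of the differences; this
forces all four numbers to be finite, where real arithmetic contradicts the failure. -/
theorem coe_sub_le_coe_sub_iff {a b u v : ℝ≥0∞} (hb : b ≠ ⊤) (hv : v ≠ ⊤) :
    (a : EReal) - b ≤ (u : EReal) - v ↔ a + v ≤ u + b := by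
  refine ⟨fun h => ?_, fun h => coe_sub_le_coe_sub h hb hv⟩
  by_contra! hlt
  have h1 : ¬ a + v ≤ u + b := not_le.2 hlt
  have h2 := coe_sub_le_coe_sub hlt.le hv hb
  have h3 := le_antisymm h h2
  have hu : u ≠ ⊤ := by rintro rfl; simp at hlt
  have ha : a ≠ ⊤ := by
    rintro rfl
    lift b to ℝ≥0 using hb
    have h4 : ((⊤ : ℝ≥0∞) : EReal) - ((b : ℝ≥0∞) : EReal) = ⊤ := EReal.top_sub_coe (b : ℝ)
    lift u to ℝ≥0 using hu
    lift v to ℝ≥0 using hv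
    rw [h4] at h3
    exact EReal.coe_ne_top ((u : ℝ) - v) h3.symm
  lift a to ℝ≥0 using ha
  lift b to ℝ≥0 using hb
  lift u to ℝ≥0 using hu
  lift v to ℝ≥0 using hv
  have h5 : ((a - b : ℝ) : EReal) ≤ ((u - v : ℝ) : EReal) := h
  rw [EReal.coe_le_coe_iff] at h5
  apply h1
  norm_cast
  have : (a : ℝ) + v ≤ u + b := by linarith
  exact_mod_cast this

theorem real_eq_coe_ofReal_sub (d : ℝ) :
    (d : EReal) = ((ENNReal.ofReal d : ℝ≥0∞) : EReal) - ((ENNReal.ofReal (-d) : ℝ≥0∞) : EReal) := by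
  change (d : EReal) = ((((d.toNNReal : ℝ) - ((-d).toNNReal : ℝ)) : ℝ) : EReal)
  rw [Real.coe_toNNReal', Real.coe_toNNReal']
  congr 1
  rcases le_total 0 d with h | h
  · rw [max_eq_left h, max_eq_right (by linarith)]; ring
  · rw [max_eq_right h, max_eq_left (by linarith)]; ring

theorem ofReal_eq_zero_or (d : ℝ) : ENNReal.ofReal d = 0 ∨ ENNReal.ofReal (-d) = 0 := by
  rcases le_total 0 d with h | h
  · right; simpa using h
  · left; simpa using h

/-! ### From conditional means to weighted integrals -/

section CondDistrib

variable {Ω β : Type*} [MeasurableSpace Ω] [MeasurableSpace β] {μ : Measure Ω} [IsFiniteMeasure μ]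
  {Y : Ω → ℝ} {R : Ω → β}

theorem lintegral_mul_eq_condDistrib (hY : Measurable Y) (hR : Measurable R)
    {w : β → ℝ≥0∞} (hw : Measurable w) {G : ℝ → ℝ≥0∞} (hG : Measurable G) :
    ∫⁻ ω, w (R ω) * G (Y ω) ∂μ =
      ∫⁻ ω, w (R ω) * ∫⁻ y, G y ∂(condDistrib Y R μ (R ω)) ∂μ := by
  have hm : Measurable fun b : β × ℝ => w b.1 * G b.2 := by fun_prop
  rw [← lintegral_map (f := fun b : β × ℝ => w b.1 * G b.2) hm (hR.prodMk hY),
    ← compProd_map_condDistrib hY.aemeasurable, Measure.lintegral_compProd hm,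
    lintegral_map hm.lintegral_kernel_prod_right' hR]
  refine lintegral_congr fun ω => ?_
  dsimp only
  exact lintegral_const_mul _ hG

theorem extIntegral_coe (ν : Measure ℝ) : extIntegral ν (fun y : ℝ => (y : EReal)) =
    ((∫⁻ y, ENNReal.ofReal y ∂ν : ℝ≥0∞) : EReal) -
      ((∫⁻ y, ENNReal.ofReal (-y) ∂ν : ℝ≥0∞) : EReal) := by
  simp only [extIntegral, EReal.real_coe_toENNReal, ← EReal.coe_neg]

theorem measurable_lintegral_condDistrib {G : ℝ → ℝ≥0∞} (hG : Measurable G) :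
    Measurable fun b => ∫⁻ y, G y ∂(condDistrib Y R μ b) := hG.lintegral_kernel

variable (hY : Measurable Y) (hR : Measurable R) {w : β → ℝ≥0∞} (hw : Measurable w)
  {D : β → ℝ} (hD : Measurable D)
  (hfin : ∫⁻ ω, w (R ω) * ENNReal.ofReal (-Y ω) ∂μ ≠ ⊤)

include hY hR hw hfin in
-- Where the weight is nonzero, the conditional mean is thus not of the form ∞ - ∞; where it
-- vanishes, the conditional mean plays no role.
theorem ae_condDistrib_neg_ne_top :
    ∀ᵐ ω ∂μ, w (R ω) ≠ 0 → ∫⁻ y, ENNReal.ofReal (-y) ∂(condDistrib Y R μ (R ω)) ≠ ⊤ := by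
  rw [lintegral_mul_eq_condDistrib hY hR hw (G := fun y => ENNReal.ofReal (-y)) (by fun_prop)] at hfin
  have hm : Measurable fun b => ∫⁻ y, ENNReal.ofReal (-y) ∂(condDistrib Y R μ b) :=
    measurable_lintegral_condDistrib (by fun_prop)
  filter_upwards [ae_lt_top ((hw.comp hR).mul (hm.comp hR)) hfin] with ω hω h0 htop
  simp [htop, ENNReal.mul_top h0] at hω

include hY hR hw hD hfin in
-- The pointwise inequality is rearranged into one between sums in [0, ∞] and integrated. The second
-- claim is what later keeps the negative part of the bound finite.
theorem lintegral_le_of_condMean_le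
    (h : ∀ᵐ ω ∂μ, extIntegral (condDistrib Y R μ (R ω)) (fun y : ℝ => (y : EReal)) ≤ (D (R ω) : EReal)) :
    (∫⁻ ω, w (R ω) * ENNReal.ofReal (Y ω) ∂μ + ∫⁻ ω, w (R ω) * ENNReal.ofReal (-D (R ω)) ∂μ ≤
      ∫⁻ ω, w (R ω) * ENNReal.ofReal (D (R ω)) ∂μ + ∫⁻ ω, w (R ω) * ENNReal.ofReal (-Y ω) ∂μ) ∧
    ∫⁻ ω, w (R ω) * ENNReal.ofReal (-D (R ω)) ∂μ ≤ ∫⁻ ω, w (R ω) * ENNReal.ofReal (-Y ω) ∂μ := by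
  have hneg := ae_condDistrib_neg_ne_top hY hR hw hfin
  have hm1 : Measurable fun b => ∫⁻ y, ENNReal.ofReal y ∂(condDistrib Y R μ b) :=
    measurable_lintegral_condDistrib (by fun_prop)
  have hm2 : Measurable fun b => ∫⁻ y, ENNReal.ofReal (-y) ∂(condDistrib Y R μ b) :=
    measurable_lintegral_condDistrib (by fun_prop)
  have key : ∀ᵐ ω ∂μ, w (R ω) = 0 ∨
      (∫⁻ y, ENNReal.ofReal y ∂(condDistrib Y R μ (R ω)) + ENNReal.ofReal (-D (R ω)) ≤
      ENNReal.ofReal (D (R ω)) + ∫⁻ y, ENNReal.ofReal (-y) ∂(condDistrib Y R μ (R ω))) := by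
    filter_upwards [h, hneg] with ω h1 h2
    refine or_iff_not_imp_left.2 fun h0 => ?_
    rwa [extIntegral_coe, real_eq_coe_ofReal_sub,
      coe_sub_le_coe_sub_iff (h2 h0) ENNReal.ofReal_ne_top] at h1
  rw [lintegral_mul_eq_condDistrib hY hR hw (G := fun y => ENNReal.ofReal (-y)) (by fun_prop),
    lintegral_mul_eq_condDistrib hY hR hw (G := fun y => ENNReal.ofReal y) (by fun_prop)]
  constructor
  · rw [← lintegral_add_left (by fun_prop), ← lintegral_add_left (by fun_prop)]
    refine lintegral_mono_ae (key.mono fun ω hω => ?_)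
    rw [← mul_add, ← mul_add]
    rcases hω with h0 | h1
    · simp [h0]
    · gcongr
  · refine lintegral_mono_ae (key.mono fun ω hω => ?_)
    rcases hω with h0 | h1
    · simp [h0]
    · gcongr
      -- The positive and negative parts of `D` are never both nonzero, so the pointwise inequality
      -- also bounds the negative part on its own.
      rcases ofReal_eq_zero_or (D (R ω)) with h2 | h2
      · rw [h2, zero_add] at h1
        exact le_add_self.trans h1
      · simp [h2]

include hY hR hw hD hfin in
theorem le_lintegral_of_le_condMean
    (h : ∀ᵐ ω ∂μ, (D (R ω) : EReal) ≤ extIntegral (condDistrib Y R μ (R ω)) (fun y : ℝ => (y : EReal))) :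
    (∫⁻ ω, w (R ω) * ENNReal.ofReal (D (R ω)) ∂μ + ∫⁻ ω, w (R ω) * ENNReal.ofReal (-Y ω) ∂μ ≤
      ∫⁻ ω, w (R ω) * ENNReal.ofReal (Y ω) ∂μ + ∫⁻ ω, w (R ω) * ENNReal.ofReal (-D (R ω)) ∂μ) ∧
    ∫⁻ ω, w (R ω) * ENNReal.ofReal (D (R ω)) ∂μ ≤ ∫⁻ ω, w (R ω) * ENNReal.ofReal (Y ω) ∂μ := by
  have hneg := ae_condDistrib_neg_ne_top hY hR hw hfin
  have hm1 : Measurable fun b => ∫⁻ y, ENNReal.ofReal y ∂(condDistrib Y R μ b) :=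
    measurable_lintegral_condDistrib (by fun_prop)
  have hm2 : Measurable fun b => ∫⁻ y, ENNReal.ofReal (-y) ∂(condDistrib Y R μ b) :=
    measurable_lintegral_condDistrib (by fun_prop)
  have key : ∀ᵐ ω ∂μ, w (R ω) = 0 ∨
      (ENNReal.ofReal (D (R ω)) + ∫⁻ y, ENNReal.ofReal (-y) ∂(condDistrib Y R μ (R ω)) ≤
      ∫⁻ y, ENNReal.ofReal y ∂(condDistrib Y R μ (R ω)) + ENNReal.ofReal (-D (R ω))) := by
    filter_upwards [h, hneg] with ω h1 h2
    refine or_iff_not_imp_left.2 fun h0 => ?_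
    rwa [extIntegral_coe, real_eq_coe_ofReal_sub,
      coe_sub_le_coe_sub_iff ENNReal.ofReal_ne_top (h2 h0)] at h1
  rw [lintegral_mul_eq_condDistrib hY hR hw (G := fun y => ENNReal.ofReal (-y)) (by fun_prop),
    lintegral_mul_eq_condDistrib hY hR hw (G := fun y => ENNReal.ofReal y) (by fun_prop)]
  constructor
  · rw [← lintegral_add_left (by fun_prop), ← lintegral_add_left (by fun_prop)]
    refine lintegral_mono_ae (key.mono fun ω hω => ?_)
    rw [← mul_add, ← mul_add]
    rcases hω with h0 | h1
    · simp [h0]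
    · gcongr
  · refine lintegral_mono_ae (key.mono fun ω hω => ?_)
    rcases hω with h0 | h1
    · simp [h0]
    · gcongr
      rcases ofReal_eq_zero_or (D (R ω)) with h2 | h2
      · simp [h2]
      · rw [h2, add_zero] at h1
        exact le_self_add.trans h1

end CondDistrib

/-! ### Products of signed series -/

theorem ofReal_mul_eq_add (s t : ℝ) : ENNReal.ofReal (s * t) =
    ENNReal.ofReal s * ENNReal.ofReal t + ENNReal.ofReal (-s) * ENNReal.ofReal (-t) := by
  rcases le_total 0 s with hs | hs
  · rw [ENNReal.ofReal_mul hs, ENNReal.ofReal_of_nonpos (p := -s) (by linarith), zero_mul, add_zero]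
  · rw [ENNReal.ofReal_of_nonpos hs, zero_mul, zero_add, ← ENNReal.ofReal_mul (by linarith), neg_mul_neg]

theorem enorm_eq_ofReal_add (s : ℝ) : ‖s‖ₑ = ENNReal.ofReal s + ENNReal.ofReal (-s) := by
  rcases le_total 0 s with hs | hs
  · rw [Real.enorm_of_nonneg hs, ENNReal.ofReal_of_nonpos (p := -s) (by linarith), add_zero]
  · rw [← enorm_neg, Real.enorm_of_nonneg (by linarith), ENNReal.ofReal_of_nonpos hs, zero_add]

theorem tsum_prod_ofReal_mul (s t : ℕ → ℝ) :
    ∑' ij : ℕ × ℕ, ENNReal.ofReal (s ij.1 * t ij.2) =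
      (∑' i, ENNReal.ofReal (s i)) * (∑' i, ENNReal.ofReal (t i)) +
      (∑' i, ENNReal.ofReal (-s i)) * (∑' i, ENNReal.ofReal (-t i)) := by
  simp_rw [ofReal_mul_eq_add, ENNReal.tsum_add, ENNReal.tsum_prod', ENNReal.tsum_mul_left,
    ENNReal.tsum_mul_right]

theorem tsum_prod_ofReal_neg_mul (s t : ℕ → ℝ) :
    ∑' ij : ℕ × ℕ, ENNReal.ofReal (-(s ij.1 * t ij.2)) =
      (∑' i, ENNReal.ofReal (s i)) * (∑' i, ENNReal.ofReal (-t i)) +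
      (∑' i, ENNReal.ofReal (-s i)) * (∑' i, ENNReal.ofReal (t i)) := by
  simpa using tsum_prod_ofReal_mul s (fun i => -t i)

/-- A finite product still permits 0 · ∞, where one factor may even be ∞ - ∞; then the other factor
is 0 and both sides vanish. -/
theorem coe_sub_mul_coe_sub_of_mul_ne_top {a a' b b' : ℝ≥0∞} (h : (a + a') * (b + b') ≠ ⊤) :
    ((a : EReal) - a') * ((b : EReal) - b') =
      ((a * b + a' * b' : ℝ≥0∞) : EReal) - ((a * b' + a' * b : ℝ≥0∞) : EReal) := by
  by_cases hA : a + a' = 0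
  · obtain ⟨rfl, rfl⟩ := add_eq_zero.1 hA
    simp
  by_cases hB : b + b' = 0
  · obtain ⟨rfl, rfl⟩ := add_eq_zero.1 hB
    simp
  have h1 : a + a' ≠ ⊤ := fun hx => h (by rw [hx, ENNReal.top_mul hB])
  have h2 : b + b' ≠ ⊤ := fun hx => h (by rw [hx, ENNReal.mul_top hA])
  rw [ENNReal.add_ne_top] at h1 h2
  exact coe_sub_mul_coe_sub (Or.inl h1.1) (Or.inl h2.1) (Or.inl (ENNReal.add_ne_top.2
    ⟨ENNReal.mul_ne_top h1.1 h2.1, ENNReal.mul_ne_top h1.2 h2.2⟩))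

theorem signed_tsum_mul_signed_tsum {s t : ℕ → ℝ}
    (h : (∀ i, 0 ≤ s i ∧ 0 ≤ t i) ∨ (∑' i, ‖s i‖ₑ) * (∑' i, ‖t i‖ₑ) ≠ ⊤) :
    (((∑' i, ENNReal.ofReal (s i) : ℝ≥0∞) : EReal) - ((∑' i, ENNReal.ofReal (-s i) : ℝ≥0∞) : EReal)) *
      (((∑' i, ENNReal.ofReal (t i) : ℝ≥0∞) : EReal) -
        ((∑' i, ENNReal.ofReal (-t i) : ℝ≥0∞) : EReal)) =
      ((∑' ij : ℕ × ℕ, ENNReal.ofReal (s ij.1 * t ij.2) : ℝ≥0∞) : EReal) -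
      ((∑' ij : ℕ × ℕ, ENNReal.ofReal (-(s ij.1 * t ij.2)) : ℝ≥0∞) : EReal) := by
  rw [tsum_prod_ofReal_mul, tsum_prod_ofReal_neg_mul]
  rcases h with h | h
  · have hs : ∑' i, ENNReal.ofReal (-s i) = 0 := by
      simp [fun i => (h i).1]
    have ht : ∑' i, ENNReal.ofReal (-t i) = 0 := by
      simp [fun i => (h i).2]
    rw [hs, ht]
    exact coe_sub_mul_coe_sub (by simp) (by simp) (by simp)
  · simp_rw [enorm_eq_ofReal_add, ENNReal.tsum_add] at h
    exact coe_sub_mul_coe_sub_of_mul_ne_top h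

/-! ### The joint moment and the bound as double series -/

section Moments

variable {Ω : Type*} [MeasurableSpace Ω] {P : Measure Ω} {alive : ℕ → Set Ω} {x : ℕ → Ω → Plane}
  {Λ : Measure Plane} {p₁ p₂ : ℕ → Ω → ℝ} {f₁ f₂ q₀ q₁ q₂ : ℝ → ℝ}

theorem measurable_shotTerm (h : IsPoissonPointProcess P alive x Λ) {f : ℝ → ℝ} (hf : Measurable f)
    {p : ℕ → Ω → ℝ} (hp : ∀ i, Measurable (p i)) (i : ℕ) : Measurable (shotTerm alive x f p i) :=
  ((hf.comp (h.measurable_point i).norm).mul (hp i)).indicator (h.measurableSet_alive i)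

omit [MeasurableSpace Ω] in
theorem shotTerm_mul_shotTerm (alive : ℕ → Set Ω) (x : ℕ → Ω → Plane) (f₁ f₂ : ℝ → ℝ)
    (p₁ p₂ : ℕ → Ω → ℝ) (i j : ℕ) :
    (fun ω => shotTerm alive x f₁ p₁ i ω * shotTerm alive x f₂ p₂ j ω) =
      (alive i ∩ alive j).indicator
        fun ω => f₁ ‖x i ω‖ * f₂ ‖x j ω‖ * (p₁ i ω * p₂ j ω) := by
  ext ω
  by_cases h1 : ω ∈ alive i <;> by_cases h2 : ω ∈ alive j <;> simp [shotTerm, h1, h2]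
  ring

theorem lintegral_ofReal_shotTerm_mul (h : IsPoissonPointProcess P alive x Λ)
    (hf₁ : ∀ r, 0 ≤ f₁ r) (hf₂ : ∀ r, 0 ≤ f₂ r) (p₁ p₂ : ℕ → Ω → ℝ) (i j : ℕ) :
    ∫⁻ ω, ENNReal.ofReal (shotTerm alive x f₁ p₁ i ω * shotTerm alive x f₂ p₂ j ω) ∂P =
      ∫⁻ ω in alive i ∩ alive j, (ENNReal.ofReal (f₁ ‖x i ω‖) * ENNReal.ofReal (f₂ ‖x j ω‖)) *
        ENNReal.ofReal (p₁ i ω * p₂ j ω) ∂P := by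
  rw [← lintegral_indicator ((h.measurableSet_alive i).inter (h.measurableSet_alive j))]
  refine lintegral_congr fun ω => ?_
  rw [congrFun (shotTerm_mul_shotTerm alive x f₁ f₂ p₁ p₂ i j) ω]
  by_cases hω : ω ∈ alive i ∩ alive j
  · rw [Set.indicator_of_mem hω, Set.indicator_of_mem hω,
      ENNReal.ofReal_mul (mul_nonneg (hf₁ _) (hf₂ _)), ENNReal.ofReal_mul (hf₁ _)]
  · rw [Set.indicator_of_notMem hω, Set.indicator_of_notMem hω, ENNReal.ofReal_zero]

omit [MeasurableSpace Ω] in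
theorem shotTerm_neg_mark (alive : ℕ → Set Ω) (x : ℕ → Ω → Plane) (f : ℝ → ℝ) (p : ℕ → Ω → ℝ)
    (i : ℕ) (ω : Ω) : shotTerm alive x f (fun i ω => -p i ω) i ω = -shotTerm alive x f p i ω := by
  by_cases h : ω ∈ alive i <;> simp [shotTerm, h]

theorem lintegral_ofReal_neg_shotTerm_mul (h : IsPoissonPointProcess P alive x Λ)
    (hf₁ : ∀ r, 0 ≤ f₁ r) (hf₂ : ∀ r, 0 ≤ f₂ r) (p₁ p₂ : ℕ → Ω → ℝ) (i j : ℕ) :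
    ∫⁻ ω, ENNReal.ofReal (-(shotTerm alive x f₁ p₁ i ω * shotTerm alive x f₂ p₂ j ω)) ∂P =
      ∫⁻ ω in alive i ∩ alive j, (ENNReal.ofReal (f₁ ‖x i ω‖) * ENNReal.ofReal (f₂ ‖x j ω‖)) *
        ENNReal.ofReal (-(p₁ i ω * p₂ j ω)) ∂P := by
  have := lintegral_ofReal_shotTerm_mul h hf₁ hf₂ (fun i ω => -p₁ i ω) p₂ i j
  simpa only [shotTerm_neg_mark, neg_mul] using this

theorem extIntegral_shotNoise_mul (h : IsPoissonPointProcess P alive x Λ)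
    (hf₁ : Measurable f₁) (hf₂ : Measurable f₂) (hf₁0 : ∀ r, 0 ≤ f₁ r) (hf₂0 : ∀ r, 0 ≤ f₂ r)
    (hp₁ : ∀ i, Measurable (p₁ i)) (hp₂ : ∀ i, Measurable (p₂ i))
    (hI : (∀ᵐ ω ∂P, ∀ i, ω ∈ alive i → 0 ≤ p₁ i ω ∧ 0 ≤ p₂ i ω) ∨
      ∫⁻ ω, (∑' i, ‖shotTerm alive x f₁ p₁ i ω‖ₑ) * (∑' i, ‖shotTerm alive x f₂ p₂ i ω‖ₑ) ∂P ≠ ⊤) :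
    ∑' ij : ℕ × ℕ, ∫⁻ ω, ENNReal.ofReal
        (-(shotTerm alive x f₁ p₁ ij.1 ω * shotTerm alive x f₂ p₂ ij.2 ω)) ∂P ≠ ⊤ ∧
    extIntegral P (fun ω => shotNoise alive x f₁ p₁ ω * shotNoise alive x f₂ p₂ ω) =
      ((∑' ij : ℕ × ℕ, ∫⁻ ω, ENNReal.ofReal
        (shotTerm alive x f₁ p₁ ij.1 ω * shotTerm alive x f₂ p₂ ij.2 ω) ∂P : ℝ≥0∞) : EReal) -
      ((∑' ij : ℕ × ℕ, ∫⁻ ω, ENNReal.ofReal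
        (-(shotTerm alive x f₁ p₁ ij.1 ω * shotTerm alive x f₂ p₂ ij.2 ω)) ∂P : ℝ≥0∞) : EReal) := by
  have m1 := measurable_shotTerm h hf₁ hp₁
  have m2 := measurable_shotTerm h hf₂ hp₂
  have mu : ∀ ij : ℕ × ℕ, Measurable fun ω => ENNReal.ofReal
      (shotTerm alive x f₁ p₁ ij.1 ω * shotTerm alive x f₂ p₂ ij.2 ω) := fun ij =>
    ((m1 ij.1).mul (m2 ij.2)).ennreal_ofReal
  have mv : ∀ ij : ℕ × ℕ, Measurable fun ω => ENNReal.ofReal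
      (-(shotTerm alive x f₁ p₁ ij.1 ω * shotTerm alive x f₂ p₂ ij.2 ω)) := fun ij =>
    ((m1 ij.1).mul (m2 ij.2)).neg.ennreal_ofReal
  rw [← lintegral_tsum fun ij => (mv ij).aemeasurable, ← lintegral_tsum fun ij => (mu ij).aemeasurable]
  have hae : ∀ᵐ ω ∂P, (∀ i, 0 ≤ shotTerm alive x f₁ p₁ i ω ∧ 0 ≤ shotTerm alive x f₂ p₂ i ω) ∨
      (∑' i, ‖shotTerm alive x f₁ p₁ i ω‖ₑ) * (∑' i, ‖shotTerm alive x f₂ p₂ i ω‖ₑ) ≠ ⊤ := by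
    rcases hI with hI | hI
    · filter_upwards [hI] with ω hω
      refine Or.inl fun i => ⟨?_, ?_⟩ <;> refine Set.indicator_apply_nonneg fun hi => ?_
      · exact mul_nonneg (hf₁0 _) (hω i hi).1
      · exact mul_nonneg (hf₂0 _) (hω i hi).2
    · filter_upwards [ae_lt_top ((Measurable.tsum fun i => (m1 i).enorm).mul
        (Measurable.tsum fun i => (m2 i).enorm)) hI] with ω hω
      exact Or.inr hω.ne
  -- For nonnegative marks the negative part vanishes; otherwise it consists of two of the four
  -- terms in the expanded product of the absolute sums.
  have hfin : ∫⁻ ω, ∑' ij : ℕ × ℕ, ENNReal.ofReal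
      (-(shotTerm alive x f₁ p₁ ij.1 ω * shotTerm alive x f₂ p₂ ij.2 ω)) ∂P ≠ ⊤ := by
    rcases hI with hI | hI
    · have : ∫⁻ ω, ∑' ij : ℕ × ℕ, ENNReal.ofReal
          (-(shotTerm alive x f₁ p₁ ij.1 ω * shotTerm alive x f₂ p₂ ij.2 ω)) ∂P = ∫⁻ ω, 0 ∂P := by
        refine lintegral_congr_ae ?_
        filter_upwards [hI] with ω hω
        refine ENNReal.tsum_eq_zero.2 fun ij => ?_
        rw [ENNReal.ofReal_eq_zero, neg_nonpos]
        refine mul_nonneg ?_ ?_ <;> refine Set.indicator_apply_nonneg fun hi => ?_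
        · exact mul_nonneg (hf₁0 _) (hω _ hi).1
        · exact mul_nonneg (hf₂0 _) (hω _ hi).2
      simp [this]
    · refine ne_top_of_le_ne_top hI (lintegral_mono fun ω => ?_)
      rw [tsum_prod_ofReal_neg_mul (fun i => shotTerm alive x f₁ p₁ i ω)
        fun i => shotTerm alive x f₂ p₂ i ω]
      simp_rw [enorm_eq_ofReal_add, ENNReal.tsum_add]
      rw [add_mul, mul_add, mul_add]
      exact add_le_add le_add_self le_self_add
  refine ⟨hfin, ?_⟩
  rw [← extIntegral_coe_sub (Measurable.tsum mu).aemeasurable (Measurable.tsum mv).aemeasurable hfin]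
  exact extIntegral_congr (hae.mono fun ω hω => signed_tsum_mul_signed_tsum hω)

/-- Off the diagonal, (st)⁺ = s⁺t⁺ + s⁻t⁻ and the integral against Λ ⊗ Λ factorizes; the diagonal is
a single integral against Λ. -/
theorem tsum_lintegral_crossBound (h : IsPoissonPointProcess P alive x Λ) [SigmaFinite Λ]
    (hf₁ : Measurable f₁) (hf₂ : Measurable f₂) (hf₁0 : ∀ r, 0 ≤ f₁ r) (hf₂0 : ∀ r, 0 ≤ f₂ r)
    (hq₀ : Measurable q₀) (hq₁ : Measurable q₁) (hq₂ : Measurable q₂) :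
    ∑' ij : ℕ × ℕ, ∫⁻ ω in alive ij.1 ∩ alive ij.2,
      (ENNReal.ofReal (f₁ ‖x ij.1 ω‖) * ENNReal.ofReal (f₂ ‖x ij.2 ω‖)) *
        ENNReal.ofReal (crossBound q₀ q₁ q₂ ij.1 ij.2 ‖x ij.1 ω‖ ‖x ij.2 ω‖) ∂P =
    ((∫⁻ z, ENNReal.ofReal (f₁ ‖z‖ * q₁ ‖z‖) ∂Λ) * (∫⁻ z, ENNReal.ofReal (f₂ ‖z‖ * q₂ ‖z‖) ∂Λ) +
      (∫⁻ z, ENNReal.ofReal (-(f₁ ‖z‖ * q₁ ‖z‖)) ∂Λ) *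
        (∫⁻ z, ENNReal.ofReal (-(f₂ ‖z‖ * q₂ ‖z‖)) ∂Λ)) +
      ∫⁻ z, ENNReal.ofReal (f₁ ‖z‖ * f₂ ‖z‖ * q₀ ‖z‖) ∂Λ := by
  rw [tsum_prod_eq_offDiag_add_diag]
  congr 1
  · have m1 : Measurable fun z : Plane => f₁ ‖z‖ * q₁ ‖z‖ := by fun_prop
    have m2 : Measurable fun z : Plane => f₂ ‖z‖ * q₂ ‖z‖ := by fun_prop
    have n1 : Measurable fun z : Plane => -(f₁ ‖z‖ * q₁ ‖z‖) := by fun_prop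
    have n2 : Measurable fun z : Plane => -(f₂ ‖z‖ * q₂ ‖z‖) := by fun_prop
    rw [← lintegral_prod_mul m1.ennreal_ofReal.aemeasurable m2.ennreal_ofReal.aemeasurable,
      ← lintegral_prod_mul n1.ennreal_ofReal.aemeasurable n2.ennreal_ofReal.aemeasurable,
      ← lintegral_add_left (by fun_prop), ← tsum_lintegral_pair h (by fun_prop)]
    refine tsum_congr fun ij => if_ctx_congr Iff.rfl (fun _ => rfl) fun hij => ?_
    refine lintegral_congr fun ω => ?_
    dsimp only
    rw [← ofReal_mul_eq_add, crossBound, if_neg hij, ← ENNReal.ofReal_mul (hf₁0 _),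
      ← ENNReal.ofReal_mul (mul_nonneg (hf₁0 _) (hf₂0 _))]
    congr 1
    ring
  · rw [← tsum_lintegral_point h (by fun_prop)]
    refine tsum_congr fun i => ?_
    rw [Set.inter_self]
    refine lintegral_congr fun ω => ?_
    rw [crossBound, if_pos rfl, ← ENNReal.ofReal_mul (hf₁0 _),
      ← ENNReal.ofReal_mul (mul_nonneg (hf₁0 _) (hf₂0 _))]

/-- The sign goes to `q₀` and to only one factor of the product, so the negative part follows from
the formula for the positive part. -/
theorem crossBound_neg (q₀ q₁ q₂ : ℝ → ℝ) (i j : ℕ) (r s : ℝ) :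
    crossBound (fun r => -q₀ r) (fun r => -q₁ r) q₂ i j r s = -crossBound q₀ q₁ q₂ i j r s := by
  unfold crossBound; split_ifs <;> simp

theorem tsum_lintegral_neg_crossBound (h : IsPoissonPointProcess P alive x Λ) [SigmaFinite Λ]
    (hf₁ : Measurable f₁) (hf₂ : Measurable f₂) (hf₁0 : ∀ r, 0 ≤ f₁ r) (hf₂0 : ∀ r, 0 ≤ f₂ r)
    (hq₀ : Measurable q₀) (hq₁ : Measurable q₁) (hq₂ : Measurable q₂) :
    ∑' ij : ℕ × ℕ, ∫⁻ ω in alive ij.1 ∩ alive ij.2,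
      (ENNReal.ofReal (f₁ ‖x ij.1 ω‖) * ENNReal.ofReal (f₂ ‖x ij.2 ω‖)) *
        ENNReal.ofReal (-crossBound q₀ q₁ q₂ ij.1 ij.2 ‖x ij.1 ω‖ ‖x ij.2 ω‖) ∂P =
    ((∫⁻ z, ENNReal.ofReal (f₁ ‖z‖ * q₁ ‖z‖) ∂Λ) * (∫⁻ z, ENNReal.ofReal (-(f₂ ‖z‖ * q₂ ‖z‖)) ∂Λ) +
      (∫⁻ z, ENNReal.ofReal (-(f₁ ‖z‖ * q₁ ‖z‖)) ∂Λ) *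
        (∫⁻ z, ENNReal.ofReal (f₂ ‖z‖ * q₂ ‖z‖) ∂Λ)) +
      ∫⁻ z, ENNReal.ofReal (-(f₁ ‖z‖ * f₂ ‖z‖ * q₀ ‖z‖)) ∂Λ := by
  have := tsum_lintegral_crossBound h hf₁ hf₂ hf₁0 hf₂0 hq₀.neg hq₁.neg hq₂
  simp only [Pi.neg_def, crossBound_neg, mul_neg, neg_neg] at this
  rw [this, add_comm (_ * _)]

theorem measurable_crossBound (hq₀ : Measurable q₀) (hq₁ : Measurable q₁) (hq₂ : Measurable q₂)
    (i j : ℕ) : Measurable fun b : ℝ × ℝ => crossBound q₀ q₁ q₂ i j b.1 b.2 := by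
  unfold crossBound
  split_ifs <;> fun_prop

end Moments

/-! ### The two bounds for globally measurable functions -/

section Bounds

variable {Ω : Type*} [MeasurableSpace Ω] {P : Measure Ω} [IsFiniteMeasure P] {dens : Plane → ℝ}
  (dens_meas : Measurable dens) (dens_nonneg : ∀ z, 0 ≤ dens z)
  (dens_loc : LocallyIntegrable dens volume)
  {alive : ℕ → Set Ω} {x : ℕ → Ω → Plane}
  (hPPP : IsPoissonPointProcess P alive x (intensityMeasure dens))
  {p₁ p₂ : ℕ → Ω → ℝ} (hp₁ : ∀ i, Measurable (p₁ i)) (hp₂ : ∀ i, Measurable (p₂ i))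
  {f₁ f₂ : ℝ → ℝ} (hf₁ : Measurable f₁) (hf₂ : Measurable f₂)
  (hf₁0 : ∀ r, 0 ≤ f₁ r) (hf₂0 : ∀ r, 0 ≤ f₂ r)
  (hI : (∀ᵐ ω ∂P, ∀ i, ω ∈ alive i → 0 ≤ p₁ i ω ∧ 0 ≤ p₂ i ω) ∨
    ∫⁻ ω, (∑' i, ‖shotTerm alive x f₁ p₁ i ω‖ₑ) * (∑' i, ‖shotTerm alive x f₂ p₂ i ω‖ₑ) ∂P ≠ ⊤)
  {q₀ q₁ q₂ : ℝ → ℝ} (hq₀ : Measurable q₀) (hq₁ : Measurable q₁) (hq₂ : Measurable q₂)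
  (hJ₁ : ExtIntegralExists (volume.restrict (Set.Ioi (0 : ℝ)))
    (radialIntegrand dens (fun r => f₁ r * q₁ r)))
  (hJ₂ : ExtIntegralExists (volume.restrict (Set.Ioi (0 : ℝ)))
    (radialIntegrand dens (fun r => f₂ r * q₂ r)))
  (hJ₀ : ExtIntegralExists (volume.restrict (Set.Ioi (0 : ℝ)))
    (radialIntegrand dens (fun r => f₁ r * f₂ r * q₀ r)))

omit [IsFiniteMeasure P] in
include dens_meas dens_nonneg dens_loc hPPP hf₁ hf₂ hf₁0 hf₂0 hq₀ hq₁ hq₂ hJ₁ hJ₂ hJ₀ in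
theorem radialIntegral_mul_add_eq
    (hfin : ∑' ij : ℕ × ℕ, ∫⁻ ω in alive ij.1 ∩ alive ij.2,
        (ENNReal.ofReal (f₁ ‖x ij.1 ω‖) * ENNReal.ofReal (f₂ ‖x ij.2 ω‖)) *
        ENNReal.ofReal (crossBound q₀ q₁ q₂ ij.1 ij.2 ‖x ij.1 ω‖ ‖x ij.2 ω‖) ∂P ≠ ⊤ ∨
      ∑' ij : ℕ × ℕ, ∫⁻ ω in alive ij.1 ∩ alive ij.2,
        (ENNReal.ofReal (f₁ ‖x ij.1 ω‖) * ENNReal.ofReal (f₂ ‖x ij.2 ω‖)) *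
        ENNReal.ofReal (-crossBound q₀ q₁ q₂ ij.1 ij.2 ‖x ij.1 ω‖ ‖x ij.2 ω‖) ∂P ≠ ⊤) :
    radialIntegral dens (fun r => f₁ r * q₁ r) * radialIntegral dens (fun r => f₂ r * q₂ r) +
        radialIntegral dens (fun r => f₁ r * f₂ r * q₀ r) =
      ((∑' ij : ℕ × ℕ, ∫⁻ ω in alive ij.1 ∩ alive ij.2,
        (ENNReal.ofReal (f₁ ‖x ij.1 ω‖) * ENNReal.ofReal (f₂ ‖x ij.2 ω‖)) *
        ENNReal.ofReal (crossBound q₀ q₁ q₂ ij.1 ij.2 ‖x ij.1 ω‖ ‖x ij.2 ω‖) ∂P : ℝ≥0∞) : EReal) -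
      ((∑' ij : ℕ × ℕ, ∫⁻ ω in alive ij.1 ∩ alive ij.2,
        (ENNReal.ofReal (f₁ ‖x ij.1 ω‖) * ENNReal.ofReal (f₂ ‖x ij.2 ω‖)) *
        ENNReal.ofReal (-crossBound q₀ q₁ q₂ ij.1 ij.2 ‖x ij.1 ω‖ ‖x ij.2 ω‖) ∂P : ℝ≥0∞) : EReal) := by
  have : SigmaFinite (intensityMeasure dens) := SigmaFinite.withDensity_ofReal _
  rw [tsum_lintegral_crossBound hPPP hf₁ hf₂ hf₁0 hf₂0 hq₀ hq₁ hq₂,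
    tsum_lintegral_neg_crossBound hPPP hf₁ hf₂ hf₁0 hf₂0 hq₀ hq₁ hq₂] at *
  have m1 : Measurable fun r => f₁ r * q₁ r := hf₁.mul hq₁
  have m2 : Measurable fun r => f₂ r * q₂ r := hf₂.mul hq₂
  have m0 : Measurable fun r => f₁ r * f₂ r * q₀ r := (hf₁.mul hf₂).mul hq₀
  rw [radialIntegral_eq dens_meas dens_nonneg dens_loc m1 hJ₁,
    radialIntegral_eq dens_meas dens_nonneg dens_loc m2 hJ₂,
    radialIntegral_eq dens_meas dens_nonneg dens_loc m0 hJ₀,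
    coe_sub_mul_coe_sub (lintegral_norm_ne_top_or dens_meas dens_nonneg dens_loc m1 hJ₁)
      (lintegral_norm_ne_top_or dens_meas dens_nonneg dens_loc m2 hJ₂)
      (hfin.imp (fun h => (ENNReal.add_ne_top.1 h).1) fun h => (ENNReal.add_ne_top.1 h).1)]
  rcases hfin with h | h
  · exact coe_sub_add_coe_sub' (ENNReal.add_ne_top.1 h).1 (ENNReal.add_ne_top.1 h).2
  · exact coe_sub_add_coe_sub (ENNReal.add_ne_top.1 h).1 (ENNReal.add_ne_top.1 h).2

include dens_meas dens_nonneg dens_loc hPPP hp₁ hp₂ hf₁ hf₂ hf₁0 hf₂0 hI hq₀ hq₁ hq₂ hJ₁ hJ₂ hJ₀ in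
theorem extIntegral_shotNoise_mul_le
    (hle : ∀ i j, ∀ᵐ ω ∂P, ω ∈ alive i ∩ alive j → crossMoment P alive x p₁ p₂ i j ω ≤
      (crossBound q₀ q₁ q₂ i j ‖x i ω‖ ‖x j ω‖ : EReal)) :
    extIntegral P (fun ω => shotNoise alive x f₁ p₁ ω * shotNoise alive x f₂ p₂ ω) ≤
      radialIntegral dens (fun r => f₁ r * q₁ r) * radialIntegral dens (fun r => f₂ r * q₂ r) +
        radialIntegral dens (fun r => f₁ r * f₂ r * q₀ r) := by
  obtain ⟨hfin, hE⟩ := extIntegral_shotNoise_mul hPPP hf₁ hf₂ hf₁0 hf₂0 hp₁ hp₂ hI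
  simp_rw [lintegral_ofReal_neg_shotTerm_mul hPPP hf₁0 hf₂0,
    lintegral_ofReal_shotTerm_mul hPPP hf₁0 hf₂0] at hE hfin
  have hx := hPPP.measurable_point
  have key := fun ij : ℕ × ℕ => lintegral_le_of_condMean_le
    (μ := P.restrict (alive ij.1 ∩ alive ij.2)) (Y := fun ω => p₁ ij.1 ω * p₂ ij.2 ω)
    (R := fun ω => (‖x ij.1 ω‖, ‖x ij.2 ω‖))
    (w := fun b => ENNReal.ofReal (f₁ b.1) * ENNReal.ofReal (f₂ b.2))
    (D := fun b => crossBound q₀ q₁ q₂ ij.1 ij.2 b.1 b.2)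
    ((hp₁ _).mul (hp₂ _)) ((hx _).norm.prodMk (hx _).norm) (by fun_prop)
    (measurable_crossBound hq₀ hq₁ hq₂ _ _) (ENNReal.ne_top_of_tsum_ne_top hfin ij)
    ((ae_restrict_iff' ((hPPP.measurableSet_alive _).inter (hPPP.measurableSet_alive _))).2
      (hle ij.1 ij.2))
  have s1 := ENNReal.tsum_le_tsum fun ij => (key ij).1
  have s2 := ENNReal.tsum_le_tsum fun ij => (key ij).2
  -- The negative part of the bound is at most that of the moment, hence finite.
  have s3 := ne_top_of_le_ne_top hfin s2
  rw [ENNReal.tsum_add, ENNReal.tsum_add] at s1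
  rw [hE, radialIntegral_mul_add_eq dens_meas dens_nonneg dens_loc hPPP hf₁ hf₂ hf₁0 hf₂0
    hq₀ hq₁ hq₂ hJ₁ hJ₂ hJ₀ (Or.inr s3)]
  exact coe_sub_le_coe_sub s1 hfin s3

include dens_meas dens_nonneg dens_loc hPPP hp₁ hp₂ hf₁ hf₂ hf₁0 hf₂0 hI hq₀ hq₁ hq₂ hJ₁ hJ₂ hJ₀ in
theorem le_extIntegral_shotNoise_mul
    (hle : ∀ i j, ∀ᵐ ω ∂P, ω ∈ alive i ∩ alive j →
      (crossBound q₀ q₁ q₂ i j ‖x i ω‖ ‖x j ω‖ : EReal) ≤ crossMoment P alive x p₁ p₂ i j ω) :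
    radialIntegral dens (fun r => f₁ r * q₁ r) * radialIntegral dens (fun r => f₂ r * q₂ r) +
        radialIntegral dens (fun r => f₁ r * f₂ r * q₀ r) ≤
      extIntegral P (fun ω => shotNoise alive x f₁ p₁ ω * shotNoise alive x f₂ p₂ ω) := by
  obtain ⟨hfin, hE⟩ := extIntegral_shotNoise_mul hPPP hf₁ hf₂ hf₁0 hf₂0 hp₁ hp₂ hI
  simp_rw [lintegral_ofReal_neg_shotTerm_mul hPPP hf₁0 hf₂0,
    lintegral_ofReal_shotTerm_mul hPPP hf₁0 hf₂0] at hE hfin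
  have hx := hPPP.measurable_point
  have key := fun ij : ℕ × ℕ => le_lintegral_of_le_condMean
    (μ := P.restrict (alive ij.1 ∩ alive ij.2)) (Y := fun ω => p₁ ij.1 ω * p₂ ij.2 ω)
    (R := fun ω => (‖x ij.1 ω‖, ‖x ij.2 ω‖))
    (w := fun b => ENNReal.ofReal (f₁ b.1) * ENNReal.ofReal (f₂ b.2))
    (D := fun b => crossBound q₀ q₁ q₂ ij.1 ij.2 b.1 b.2)
    ((hp₁ _).mul (hp₂ _)) ((hx _).norm.prodMk (hx _).norm) (by fun_prop)
    (measurable_crossBound hq₀ hq₁ hq₂ _ _) (ENNReal.ne_top_of_tsum_ne_top hfin ij)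
    ((ae_restrict_iff' ((hPPP.measurableSet_alive _).inter (hPPP.measurableSet_alive _))).2
      (hle ij.1 ij.2))
  have s1 := ENNReal.tsum_le_tsum fun ij => (key ij).1
  have s2 := ENNReal.tsum_le_tsum fun ij => (key ij).2
  rw [ENNReal.tsum_add, ENNReal.tsum_add] at s1
  by_cases htop : ∑' ij : ℕ × ℕ, ∫⁻ ω in alive ij.1 ∩ alive ij.2,
      (ENNReal.ofReal (f₁ ‖x ij.1 ω‖) * ENNReal.ofReal (f₂ ‖x ij.2 ω‖)) *
        ENNReal.ofReal (p₁ ij.1 ω * p₂ ij.2 ω) ∂P = ⊤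
  -- Infinite positive part and finite negative part: the moment is ∞.
  · rw [hE, htop, (coe_sub_eq_coe_sub (v := 0) (u := ⊤) (by simp) hfin (by simp))]
    simp
  · have s3 := ne_top_of_le_ne_top htop s2
    rw [hE, radialIntegral_mul_add_eq dens_meas dens_nonneg dens_loc hPPP hf₁ hf₂ hf₁0 hf₂0
      hq₀ hq₁ hq₂ hJ₁ hJ₂ hJ₀ (Or.inl s3)]
    by_cases hn : ∑' ij : ℕ × ℕ, ∫⁻ ω in alive ij.1 ∩ alive ij.2,
        (ENNReal.ofReal (f₁ ‖x ij.1 ω‖) * ENNReal.ofReal (f₂ ‖x ij.2 ω‖)) *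
        ENNReal.ofReal (-crossBound q₀ q₁ q₂ ij.1 ij.2 ‖x ij.1 ω‖ ‖x ij.2 ω‖) ∂P = ⊤
    -- Here the bound itself is -∞.
    · rw [hn, EReal.coe_ennreal_top, EReal.sub_top]
      · exact bot_le
    · exact coe_sub_le_coe_sub s1 hn hfin

end Bounds

/-! ### Reduction from functions on (0, ∞) to functions on the line -/

section Congr

variable {dens : Plane → ℝ} {g g' : ℝ → ℝ}

theorem radialIntegrand_ae_eq (h : Set.EqOn g g' (Set.Ioi 0)) :
    radialIntegrand dens g =ᵐ[volume.restrict (Set.Ioi (0 : ℝ))] radialIntegrand dens g' := by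
  filter_upwards [ae_restrict_mem measurableSet_Ioi] with r hr
  rw [radialIntegrand, radialIntegrand, h hr]

theorem radialIntegral_congr (h : Set.EqOn g g' (Set.Ioi 0)) :
    radialIntegral dens g = radialIntegral dens g' := by
  rw [radialIntegral, radialIntegral, extIntegral_congr (radialIntegrand_ae_eq h)]

theorem extIntegralExists_radialIntegrand_congr (h : Set.EqOn g g' (Set.Ioi 0)) :
    ExtIntegralExists (volume.restrict (Set.Ioi (0 : ℝ))) (radialIntegrand dens g) ↔
      ExtIntegralExists (volume.restrict (Set.Ioi (0 : ℝ))) (radialIntegrand dens g') := by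
  have h' := radialIntegrand_ae_eq (dens := dens) h
  unfold ExtIntegralExists
  rw [lintegral_congr_ae (h'.mono fun a ha => congrArg EReal.toENNReal ha),
    lintegral_congr_ae (h'.mono fun a ha => congrArg (fun y => EReal.toENNReal (-y)) ha)]

theorem measurable_indicator_of_continuousOn {f : ℝ → ℝ} (hf : ContinuousOn f (Set.Ioi 0)) :
    Measurable ((Set.Ioi (0 : ℝ)).indicator f) := by
  rw [← Set.piecewise_eq_indicator]
  exact hf.measurable_piecewise continuousOn_const measurableSet_Ioi

end Congr

end ShotNoise

theorem theorem1 {Ω : Type*} [MeasurableSpace Ω] (P : Measure Ω) [IsProbabilityMeasure P]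
    -- the density of the process
    (dens : Plane → ℝ) (dens_meas : Measurable dens) (dens_nonneg : ∀ z, 0 ≤ dens z)
    (dens_loc : LocallyIntegrable dens volume)
    -- the points and their marks
    (alive : ℕ → Set Ω) (x : ℕ → Ω → Plane)
    (hPPP : IsPoissonPointProcess P alive x (intensityMeasure dens))
    (p₁ p₂ : ℕ → Ω → ℝ) (hp₁ : ∀ i, Measurable (p₁ i)) (hp₂ : ∀ i, Measurable (p₂ i))
    -- the response functions
    (f₁ f₂ : ℝ → ℝ) (hf₁ : ContinuousOn f₁ (Set.Ioi 0)) (hf₂ : ContinuousOn f₂ (Set.Ioi 0))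
    (hf₁_nonneg : ∀ r, 0 < r → 0 ≤ f₁ r) (hf₂_nonneg : ∀ r, 0 < r → 0 ≤ f₂ r)
    -- the second joint moment makes sense: the marks are nonnegative,
    -- or the double sum converges absolutely in mean
    (hI : (∀ᵐ ω ∂P, ∀ i, ω ∈ alive i → 0 ≤ p₁ i ω ∧ 0 ≤ p₂ i ω) ∨
      ∫⁻ ω, (∑' i, ‖shotTerm alive x f₁ p₁ i ω‖ₑ) * (∑' i, ‖shotTerm alive x f₂ p₂ i ω‖ₑ) ∂P ≠ ⊤)
    -- the bounding functions
    (q₀ q₁ q₂ : ℝ → ℝ) (hq₀ : ContinuousOn q₀ (Set.Ioi 0)) (hq₁ : ContinuousOn q₁ (Set.Ioi 0))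
    (hq₂ : ContinuousOn q₂ (Set.Ioi 0))
    -- the three radial integrals exist in the extended real numbers
    (hJ₁ : ExtIntegralExists (volume.restrict (Set.Ioi (0 : ℝ)))
      (radialIntegrand dens (fun r => f₁ r * q₁ r)))
    (hJ₂ : ExtIntegralExists (volume.restrict (Set.Ioi (0 : ℝ)))
      (radialIntegrand dens (fun r => f₂ r * q₂ r)))
    (hJ₀ : ExtIntegralExists (volume.restrict (Set.Ioi (0 : ℝ)))
      (radialIntegrand dens (fun r => f₁ r * f₂ r * q₀ r))) :
    ((∀ i j, ∀ᵐ ω ∂P, ω ∈ alive i ∩ alive j →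
        crossMoment P alive x p₁ p₂ i j ω ≤
          (crossBound q₀ q₁ q₂ i j ‖x i ω‖ ‖x j ω‖ : EReal)) →
      extIntegral P (fun ω => shotNoise alive x f₁ p₁ ω * shotNoise alive x f₂ p₂ ω) ≤
        radialIntegral dens (fun r => f₁ r * q₁ r) * radialIntegral dens (fun r => f₂ r * q₂ r) +
          radialIntegral dens (fun r => f₁ r * f₂ r * q₀ r)) ∧
    ((∀ i j, ∀ᵐ ω ∂P, ω ∈ alive i ∩ alive j →
        (crossBound q₀ q₁ q₂ i j ‖x i ω‖ ‖x j ω‖ : EReal) ≤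
          crossMoment P alive x p₁ p₂ i j ω) →
      radialIntegral dens (fun r => f₁ r * q₁ r) * radialIntegral dens (fun r => f₂ r * q₂ r) +
          radialIntegral dens (fun r => f₁ r * f₂ r * q₀ r) ≤
        extIntegral P (fun ω => shotNoise alive x f₁ p₁ ω * shotNoise alive x f₂ p₂ ω)) := by
  -- The given functions are controlled only on (0, ∞); extending them by 0 makes them measurable
  -- everywhere and keeps `f₁` and `f₂` nonnegative.
  set F₁ := (Set.Ioi (0 : ℝ)).indicator f₁ with hF₁
  set F₂ := (Set.Ioi (0 : ℝ)).indicator f₂ with hF₂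
  set Q₀ := (Set.Ioi (0 : ℝ)).indicator q₀ with hQ₀
  set Q₁ := (Set.Ioi (0 : ℝ)).indicator q₁ with hQ₁
  set Q₂ := (Set.Ioi (0 : ℝ)).indicator q₂ with hQ₂
  have mF₁ : Measurable F₁ := ShotNoise.measurable_indicator_of_continuousOn hf₁
  have mF₂ : Measurable F₂ := ShotNoise.measurable_indicator_of_continuousOn hf₂
  have mQ₀ : Measurable Q₀ := ShotNoise.measurable_indicator_of_continuousOn hq₀
  have mQ₁ : Measurable Q₁ := ShotNoise.measurable_indicator_of_continuousOn hq₁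
  have mQ₂ : Measurable Q₂ := ShotNoise.measurable_indicator_of_continuousOn hq₂
  have F₁0 : ∀ r, 0 ≤ F₁ r := fun r => Set.indicator_apply_nonneg fun hr => hf₁_nonneg r hr
  have F₂0 : ∀ r, 0 ≤ F₂ r := fun r => Set.indicator_apply_nonneg fun hr => hf₂_nonneg r hr
  have e₁ : Set.EqOn (fun r => f₁ r * q₁ r) (fun r => F₁ r * Q₁ r) (Set.Ioi 0) := fun r hr => by
    simp only [hF₁, hQ₁, Set.indicator_of_mem hr]
  have e₂ : Set.EqOn (fun r => f₂ r * q₂ r) (fun r => F₂ r * Q₂ r) (Set.Ioi 0) := fun r hr => by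
    simp only [hF₂, hQ₂, Set.indicator_of_mem hr]
  have e₀ : Set.EqOn (fun r => f₁ r * f₂ r * q₀ r) (fun r => F₁ r * F₂ r * Q₀ r) (Set.Ioi 0) :=
    fun r hr => by simp only [hF₁, hF₂, hQ₀, Set.indicator_of_mem hr]
  rw [ShotNoise.extIntegralExists_radialIntegrand_congr e₁] at hJ₁
  rw [ShotNoise.extIntegralExists_radialIntegrand_congr e₂] at hJ₂
  rw [ShotNoise.extIntegralExists_radialIntegrand_congr e₀] at hJ₀
  rw [ShotNoise.radialIntegral_congr e₁, ShotNoise.radialIntegral_congr e₂,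
    ShotNoise.radialIntegral_congr e₀]
  have : SigmaFinite (intensityMeasure dens) := SigmaFinite.withDensity_ofReal _
  -- The origin has zero intensity, so almost surely no present point lies there and the change at
  -- radius 0 is invisible.
  have hpos : ∀ᵐ ω ∂P, ∀ i, ω ∈ alive i → ‖x i ω‖ ∈ Set.Ioi (0 : ℝ) := by
    have h0 : intensityMeasure dens {0} = 0 :=
      withDensity_absolutelyContinuous _ _ (measure_singleton 0)
    filter_upwards [ShotNoise.ae_point_ne hPPP h0] with ω hω i hi
    exact norm_pos_iff.2 (hω i hi)
  have hterm : ∀ᵐ ω ∂P, (∀ i, shotTerm alive x f₁ p₁ i ω = shotTerm alive x F₁ p₁ i ω) ∧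
      ∀ i, shotTerm alive x f₂ p₂ i ω = shotTerm alive x F₂ p₂ i ω := by
    filter_upwards [hpos] with ω hω
    refine ⟨fun i => ?_, fun i => ?_⟩ <;> by_cases hi : ω ∈ alive i
    · simp only [shotTerm, Set.indicator_of_mem hi, hF₁, Set.indicator_of_mem (hω i hi)]
    · simp only [shotTerm, Set.indicator_of_notMem hi]
    · simp only [shotTerm, Set.indicator_of_mem hi, hF₂, Set.indicator_of_mem (hω i hi)]
    · simp only [shotTerm, Set.indicator_of_notMem hi]
  have hE : extIntegral P (fun ω => shotNoise alive x f₁ p₁ ω * shotNoise alive x f₂ p₂ ω) =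
      extIntegral P (fun ω => shotNoise alive x F₁ p₁ ω * shotNoise alive x F₂ p₂ ω) := by
    refine ShotNoise.extIntegral_congr (hterm.mono fun ω hω => ?_)
    simp only [shotNoise, hω.1, hω.2]
  have hI' : (∀ᵐ ω ∂P, ∀ i, ω ∈ alive i → 0 ≤ p₁ i ω ∧ 0 ≤ p₂ i ω) ∨
      ∫⁻ ω, (∑' i, ‖shotTerm alive x F₁ p₁ i ω‖ₑ) * (∑' i, ‖shotTerm alive x F₂ p₂ i ω‖ₑ) ∂P ≠ ⊤ := by
    rwa [← lintegral_congr_ae (hterm.mono fun ω hω => ?_)]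
    simp only [hω.1, hω.2]
  have hcb : ∀ᵐ ω ∂P, ∀ i j, ω ∈ alive i ∩ alive j →
      crossBound Q₀ Q₁ Q₂ i j ‖x i ω‖ ‖x j ω‖ = crossBound q₀ q₁ q₂ i j ‖x i ω‖ ‖x j ω‖ := by
    filter_upwards [hpos] with ω hω i j hij
    simp only [crossBound, hQ₀, hQ₁, hQ₂, Set.indicator_of_mem (hω i hij.1),
      Set.indicator_of_mem (hω j hij.2)]
  rw [hE]
  refine ⟨fun h => ?_, fun h => ?_⟩
  · refine ShotNoise.extIntegral_shotNoise_mul_le dens_meas dens_nonneg dens_loc hPPP hp₁ hp₂ mF₁ mF₂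
      F₁0 F₂0 hI' mQ₀ mQ₁ mQ₂ hJ₁ hJ₂ hJ₀ fun i j => ?_
    filter_upwards [h i j, hcb] with ω h1 h2 hω
    rw [h2 i j hω]
    exact h1 hω
  · refine ShotNoise.le_extIntegral_shotNoise_mul dens_meas dens_nonneg dens_loc hPPP hp₁ hp₂ mF₁ mF₂
      F₁0 F₂0 hI' mQ₀ mQ₁ mQ₂ hJ₁ hJ₂ hJ₀ fun i j => ?_
    filter_upwards [h i j, hcb] with ω h1 h2 hω
    rw [h2 i j hω]
    exact h1 hω
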